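/- Let $N\ge 2$ and let $\Omega\subset\mathbb R^N$ be a bounded polyhedral domain (open and connected, with $\operatorname{int}\overline\Omega=\Omega$ and $\overline\Omega$ a finite union of full-dimensional compact convex polytopes). Let $p:\overline\Omega\to[p_1,2]$, $1<p_1\le 2$, be log-Hölder continuous, i.e. $|p(x)-p(y)|\le C/\log(e+1/|x-y|)$, and put $p'(x)=p(x)/(p(x)-1)$. Let $\xi\in L^2(\Omega)$ and let $u_D\in L^2(\partial\Omega)$ be the boundary datum (for instance the trace of a function in $W^{2,2}(\Omega)$ on a Lipschitz $\Omega$). Let $\mathcal T$ be a fixed mesh: a finite partition of $\overline\Omega$ into (closed, full-dimensional) polyhedra with pairwise disjoint interiors. The faces are the sets $\kappa\cap\kappa'$ ($\kappa\ne\kappa'$ in $\mathcal T$) and $\kappa\cap\partial\Omega$ of Hausdorff dimension $N-1$; $\Gamma_{int}$ is the union of the faces $e$ with $\dim_H(e\cap\partial\Omega)<N-1$; $\mathbf h(x)=\operatorname{diam} e$ for $x$ in a face $e$; $dS$ is surface measure. For $k\in\mathbb N_0$, $S^k(\mathcal T)$ is the space of functions that are on each element a polynomial of degree at most $k$. On $\Gamma_{int}$,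 $[\![v]\!]=v^+\nu^++v^-\nu^-$ is the jump ($\nu^\pm$ the outward unit normals of the two adjacent elements) and $\{\phi\}=(\phi^++\phi^-)/2$ the average; $\nabla v$ is the elementwise gradient. Let $k,l\in\mathbb N_0$ with $l\ge k-1$, $V=S^k(\mathcal T)$ with the $L^2(\Omega)$ norm and $H=S^l(\mathcal T)^N$ with the $L^2(\Omega)^N$ inner product $\langle\cdot,\cdot\rangle$ and norm $\|\cdot\|$. The lifting $R(v)\in H$ of $v\in V$ is defined by $\int_\Omega\langle R(v),\phi\rangle\,dx=-\int_{\Gamma_{int}}\langle[\![v]\!],\{\phi\}\rangle\,dS$ for all $\phi\in H$. Put $Bv=R(v)+\nabla v$, $$F(q)=\int_\Omega|q|^{p(x)}dx,\qquad G(v)=\int_\Omega|v-\xi|^2dx+\int_{\Gamma_{int}}|[\![v]\!]|^2\mathbf h^{-2/p'(x)}dS+\int_{\partial\Omega}|v-u_D|^2\mathbf h^{-2/p'(x)}dS,$$ $$\mathcal L_r(v,q,\lambda)=F(q)+G(v)+\langle\lambda,Bv-q\rangle+\tfrac r2\|Bv-q\|^2 .$$ **Theorem.** Let $(u_h,\eta_h,\lambda_h)\in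 V\times H\times H$ be a saddle point of $\mathcal L_r$, i.e. $\mathcal L_r(u_h,\eta_h,\mu)\le\mathcal L_r(u_h,\eta_h,\lambda_h)\le\mathcal L_r(v,q,\lambda_h)$ for all $(v,q,\mu)\in V\times H\times H$. Let $$0<\rho<r\,\frac{1+\sqrt5}2 ,$$ let $(\eta^0,\lambda^1)\in H\times H$ be arbitrary, and let $(u^n,\eta^n,\lambda^{n+1})\in V\times H\times H$, $n\ge1$, satisfy $$G(v)-G(u^n)+\langle\lambda^n,B(v-u^n)\rangle+r\langle Bu^n-\eta^{n-1},B(v-u^n)\rangle\ge0\quad\forall v\in V,$$ $$F(q)-F(\eta^n)-\langle\lambda^n,q-\eta^n\rangle+r\langle\eta^n-Bu^n,q-\eta^n\rangle\ge0\quad\forall q\in H,$$ $$\lambda^{n+1}=\lambda^n+\rho(Bu^n-\eta^n).$$ Then $\eta_h=Bu_h$ and, as $n\to\infty$, - $\eta^n\to\eta_h=Bu_h$ in $H$, $\lambda^{n+1}-\lambda^n\to0$ in $H$, and $(\lambda^n)_{n\ge1}$ is bounded in $H$; - $u^n\to u_h$ in $V$; - $[\![u^n-u_h]\!]\to0$ in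 $L^2(\Gamma_{int})$ and $u^n\to u_h$ in $L^2(\partial\Omega)$; - $R(u^n)\to R(u_h)$ in $H$ and $\nabla u^n\to\nabla u_h$ in $H$. -/

import Mathlib

open MeasureTheory Filter Topology

noncomputable section

namespace DGp

/-! ### Polyhedra, polyhedral domains, meshes -/

/-- Euclidean space `ℝ^N`. -/
abbrev E (N : ℕ) : Type := EuclideanSpace ℝ (Fin N)

/-- A convex polytope with nonempty interior: a bounded set with nonempty interior that is a finite
intersection of closed half-spaces. -/
def IsConvexPolytope {N : ℕ} (K : Set (E N)) : Prop :=
  Bornology.IsBounded K ∧ (interior K).Nonempty ∧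
    ∃ s : Finset (E N × ℝ), K = {x | ∀ c ∈ s, inner ℝ c.1 x ≤ c.2}

/-- A (closed, bounded, full-dimensional, possibly nonconvex) polyhedron: a nonempty finite union of
convex polytopes with nonempty interior. -/
def IsPolyhedron {N : ℕ} (κ : Set (E N)) : Prop :=
  ∃ C : Finset (Set (E N)), C.Nonempty ∧ (∀ K ∈ C, IsConvexPolytope K) ∧ κ = ⋃ K ∈ C, K

/-- A bounded polyhedral domain: an open connected set whose closure is a polyhedron and that does
not lie on both sides of its boundary. Every bounded Lipschitz domain with polyhedral closure is of
this kind. -/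
structure IsPolyhedralDomain {N : ℕ} (Ω : Set (E N)) : Prop where
  isOpen : IsOpen Ω
  isConnected : IsConnected Ω
  regular : interior (closure Ω) = Ω
  polyhedral : IsPolyhedron (closure Ω)

/-- A mesh of `Ω`: a finite partition of `closure Ω` into polyhedra with pairwise disjoint
interiors. -/
structure Mesh {N : ℕ} (Ω : Set (E N)) where
  elements : Finset (Set (E N))
  polyhedral : ∀ κ ∈ elements, IsPolyhedron κ
  cover : (⋃ κ ∈ elements, κ) = closure Ω
  disjoint : ∀ κ ∈ elements, ∀ κ' ∈ elements, κ ≠ κ' → Disjoint (interior κ) (interior κ')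

/-- The `(N - 1)`-dimensional surface measure `dS`. -/
abbrev surf (N : ℕ) : Measure (E N) := μHE[N - 1]

/-- `ν` is the outward unit normal of `κ` at `x`: near `x` the set `κ` coincides with the closed
half-space through `x` with outward unit normal `ν`. There is at most one such `ν`. -/
def IsOuterNormal {N : ℕ} (κ : Set (E N)) (x ν : E N) : Prop :=
  ‖ν‖ = 1 ∧ ∀ᶠ y in 𝓝 x, (y ∈ κ ↔ inner ℝ ν (y - x) ≤ 0)

open Classical in
/-- The outward unit normal of `κ` at `x`; for a polyhedron it exists at almost every boundary point.
It is set to `0` where it does not exist. -/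
def outerNormal {N : ℕ} (κ : Set (E N)) (x : E N) : E N :=
  if h : ∃ ν, IsOuterNormal κ x ν then h.choose else 0

/-- Log-Hölder continuity on `s`. -/
def LogHolderOn {N : ℕ} (α : E N → ℝ) (s : Set (E N)) : Prop :=
  ∃ C : ℝ, ∀ x ∈ s, ∀ y ∈ s, |α x - α y| ≤ C / Real.log (Real.exp 1 + 1 / ‖x - y‖)

namespace Mesh

variable {N : ℕ} {Ω : Set (E N)}

/-- The set `ℰ` of faces: the sets `κ ∩ κ'` (with `κ ≠ κ'` elements) and `κ ∩ ∂Ω` of Hausdorff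
dimension `N - 1`. -/
def faces (T : Mesh Ω) : Set (Set (E N)) :=
  {e | (∃ κ ∈ T.elements, ∃ κ' ∈ T.elements, κ ≠ κ' ∧ e = κ ∩ κ' ∧ dimH e = ((N - 1 : ℕ) : ENNReal)) ∨
    (∃ κ ∈ T.elements, e = κ ∩ frontier Ω ∧ dimH e = ((N - 1 : ℕ) : ENNReal))}

/-- `Γ_int`: the union of the faces that meet `∂Ω` in dimension less than `N - 1`. -/
def Γint (T : Mesh Ω) : Set (E N) :=
  ⋃ e ∈ {e ∈ T.faces | dimH (e ∩ frontier Ω) < ((N - 1 : ℕ) : ENNReal)}, e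

/-- The local mesh size `𝐡` on `∂Ω ∪ Γ_int`: `𝐡(x) = diam e` for `x` in a face `e`. Almost every point
of `∂Ω ∪ Γ_int` lies in exactly one face; at the others the largest diameter is taken. -/
def hloc (T : Mesh Ω) (x : E N) : ℝ :=
  sSup (Metric.diam '' {e ∈ T.faces | x ∈ e})

open Classical in
/-- The elements that contain `x`. -/
def at_ (T : Mesh Ω) (x : E N) : Finset {κ // κ ∈ T.elements} :=
  Finset.univ.filter fun κ => x ∈ κ.1

/-! ### Discrete spaces -/

/-- `S^k(T)`: piecewise polynomials of degree at most `k`. As the elements have nonempty interior and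
overlap in null sets only, such a function is the same as a family of polynomials, one for each
element. -/
abbrev S (T : Mesh Ω) (k : ℕ) : Type :=
  {κ // κ ∈ T.elements} → MvPolynomial.restrictTotalDegree (Fin N) ℝ k

/-- `H = S^l(T)^N`. -/
abbrev H (T : Mesh Ω) (l : ℕ) : Type := Fin N → T.S l

variable {T : Mesh Ω} {k l : ℕ}

/-- The value at `x` of the polynomial that `v` has on `κ`, that is, the trace of `v` from `κ`. -/
def piece (v : T.S k) (κ : {κ // κ ∈ T.elements}) (x : E N) : ℝ :=
  MvPolynomial.eval (fun i => x i) (v κ : MvPolynomial (Fin N) ℝ)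

/-- The mean of the values at `x` from the elements that contain `x`. At almost every point of `Ω` and
of `∂Ω` there is one such element, and this is the value, or the trace on `∂Ω`, of `v`; at almost
every point of `Γ_int` there are two, and this is the average `{v} = (v⁺ + v⁻) / 2`. -/
def val (v : T.S k) (x : E N) : ℝ :=
  ((T.at_ x).card : ℝ)⁻¹ * ∑ κ ∈ T.at_ x, piece v κ x

/-- The vector-valued version of `val`. -/
def vval (q : T.H l) (x : E N) : E N :=
  WithLp.toLp 2 fun i => val (q i) x

/-- The jump `⟦v⟧ = v⁺ ν⁺ + v⁻ ν⁻` (at almost every point of `Γ_int` the sum has two terms). -/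
def jump (v : T.S k) (x : E N) : E N :=
  ∑ κ ∈ T.at_ x, piece v κ x • outerNormal κ.1 x

/-- The `L²(Ω)^N` inner product on `H`. -/
def innerH (q w : T.H l) : ℝ := ∫ x in Ω, inner ℝ (vval q x) (vval w x)

/-- The `L²(Ω)` norm on `S^k(T)`. -/
def normV (v : T.S k) : ENNReal := eLpNorm (val v) 2 (volume.restrict Ω)

/-- The `L²(Ω)^N` norm on `H`. -/
def normH (q : T.H l) : ENNReal := eLpNorm (vval q) 2 (volume.restrict Ω)

/-- The `L²(Γ_int)` norm of the jump. -/
def normJump (v : T.S k) : ENNReal := eLpNorm (jump v) 2 ((surf N).restrict T.Γint)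

/-- The `L²(∂Ω)` norm of the trace. -/
def normBdry (v : T.S k) : ENNReal := eLpNorm (val v) 2 ((surf N).restrict (frontier Ω))

/-! ### Broken gradient, lifting, and the operator `B` -/

theorem pderiv_mem {σ : Type*} (hkl : k ≤ l + 1) (i : σ) {P : MvPolynomial σ ℝ}
    (hP : P ∈ MvPolynomial.restrictTotalDegree σ ℝ k) :
    MvPolynomial.pderiv i P ∈ MvPolynomial.restrictTotalDegree σ ℝ l := by
  classical
  rw [MvPolynomial.mem_restrictTotalDegree] at hP
  rw [P.as_sum, map_sum]
  refine Submodule.sum_mem _ fun m hm => ?_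
  rw [MvPolynomial.pderiv_monomial, MvPolynomial.mem_restrictTotalDegree]
  by_cases hmi : m i = 0
  · simp [hmi]
  refine (MvPolynomial.totalDegree_monomial_le _ _).trans ?_
  have h1 : m.sum (fun _ e => e) ≤ k := (MvPolynomial.le_totalDegree hm).trans hP
  have h2 : Finsupp.single i 1 ≤ m := by
    rw [Finsupp.single_le_iff]
    omega
  have h3 : (m - Finsupp.single i 1).sum (fun _ e => e) + 1 = m.sum (fun _ e => e) := by
    conv_rhs => rw [← tsub_add_cancel_of_le h2]
    rw [Finsupp.sum_add_index' (by simp) (by simp)]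
    simp
  change (m - Finsupp.single i 1).sum (fun _ e => e) ≤ l
  omega

/-- The elementwise gradient `∇v`; it lies in `S^l(T)^N` when `k - 1 ≤ l`. -/
def grad (hkl : k ≤ l + 1) (v : T.S k) : T.H l := fun i κ =>
  ⟨MvPolynomial.pderiv i (v κ : MvPolynomial (Fin N) ℝ), pderiv_mem hkl i (v κ).2⟩

/-- `R` is the lifting of `v`: `∫_Ω ⟨R, φ⟩ = - ∫_{Γ_int} ⟨⟦v⟧, {φ}⟩ dS` for all `φ ∈ S^l(T)^N`. -/
def IsLifting (v : T.S k) (R : T.H l) : Prop :=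
  ∀ φ : T.H l, innerH R φ = -∫ x in T.Γint, inner ℝ (jump v x) (vval φ x) ∂(surf N)

/-- The lifting operator: `R(v)` is the unique solution in `S^l(T)^N` of its defining identity. -/
def lift (l : ℕ) (v : T.S k) : T.H l := Classical.epsilon (IsLifting v)

/-- `B v = R(v) + ∇v`. -/
def B (hkl : k ≤ l + 1) (v : T.S k) : T.H l := lift l v + grad hkl v

/-! ### Functionals, augmented Lagrangian, and the algorithm -/

/-- `F(q) = ∫_Ω |q|^{p(x)} dx`. -/
def F (p : E N → ℝ) (q : T.H l) : ℝ := ∫ x in Ω, ‖vval q x‖ ^ p x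

/-- The conjugate exponent `p'(x) = p(x) / (p(x) - 1)`. -/
def conj (p : E N → ℝ) (x : E N) : ℝ := p x / (p x - 1)

/-- `G(v) = ∫_Ω |v - ξ|² dx + ∫_{Γ_int} |⟦v⟧|² 𝐡^{-2/p'(x)} dS + ∫_{∂Ω} |v - u_D|² 𝐡^{-2/p'(x)} dS`. -/
def G (p ξ uD : E N → ℝ) (v : T.S k) : ℝ :=
  (∫ x in Ω, |val v x - ξ x| ^ 2) +
    (∫ x in T.Γint, ‖jump v x‖ ^ 2 * T.hloc x ^ (-2 / conj p x) ∂(surf N)) +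
    ∫ x in frontier Ω, |val v x - uD x| ^ 2 * T.hloc x ^ (-2 / conj p x) ∂(surf N)

/-- The augmented Lagrangian `F(q) + G(v) + ⟨λ, Bv - q⟩ + (r/2) ‖Bv - q‖²`. -/
def Lagr (hkl : k ≤ l + 1) (p ξ uD : E N → ℝ) (r : ℝ) (v : T.S k) (q lam : T.H l) : ℝ :=
  F p q + G p ξ uD v + innerH lam (B hkl v - q) + r / 2 * innerH (B hkl v - q) (B hkl v - q)

/-- `(u, η, lam)` is a saddle point of the augmented Lagrangian. -/
def IsSaddle (hkl : k ≤ l + 1) (p ξ uD : E N → ℝ) (r : ℝ) (u : T.S k) (η lam : T.H l) : Prop :=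
  ∀ (v : T.S k) (q μ : T.H l),
    Lagr hkl p ξ uD r u η μ ≤ Lagr hkl p ξ uD r u η lam ∧
      Lagr hkl p ξ uD r u η lam ≤ Lagr hkl p ξ uD r v q lam

/-- `u n`, `η n`, `lam n` are produced by the uncoupled algorithm with constant step `ρ`, from the
arbitrary initial values `η 0` and `lam 1`: for each `n ≥ 1`, `u n`, then `η n`, then `lam (n + 1)`.
The entries `u 0` and `lam 0` are not used. -/
def IsAlgorithm2 (hkl : k ≤ l + 1) (p ξ uD : E N → ℝ) (r ρ : ℝ)
    (u : ℕ → T.S k) (η lam : ℕ → T.H l) : Prop :=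
  ∀ n : ℕ, 1 ≤ n →
    (∀ v : T.S k, 0 ≤ G p ξ uD v - G p ξ uD (u n) + innerH (lam n) (B hkl (v - u n)) +
      r * innerH (B hkl (u n) - η (n - 1)) (B hkl (v - u n))) ∧
    (∀ q : T.H l, 0 ≤ F p q - F p (η n) - innerH (lam n) (q - η n) +
      r * innerH (η n - B hkl (u n)) (q - η n)) ∧
    lam (n + 1) = lam n + ρ • (B hkl (u n) - η n)

end Mesh

end DGp

end

noncomputable section

namespace DGp

/-! ### Geometry of polyhedra -/

/-! The argument is a Lyapunov estimate for the errors `b n = B (u n - uh)`, `e n = η n - ηh`, `L n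
= lam n - lamh`, with residual `s n = b n - e n`. Testing the saddle point and the iteration against
each other cancels all values of `F` and `G`. The fidelity term makes `G` strongly convex in
`L²(Ω)`, so the two primal inequalities leave a surplus of twice `a n = ‖u n - uh‖²`; convexity of
`F` gives the dual inequality, and comparing two consecutive `η`-steps bounds the cross term between
`s n` and `e n - e (n - 1)`. Hence (`lyapunov_step`) the energy `‖L (n + 1)‖² + ρ r ‖e n‖² + ρ (r -
ρ)² / r ‖s n‖²` drops at each step by at least `ρ m ‖s n‖² + 4 ρ a n`, where `m = 2 r - ρ - (r - ρ)²
/ r`. This `m` is positive exactly up to the golden-ratio bound on `ρ / r` (`stepSize_margin_pos`).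
So `s n → 0`, `a n → 0` and `L n` stays bounded (`augmented_lagrangian_convergence`). The rest is
finite-dimensional: `S^k(T)` embeds in `L²(Ω)`, so every linear map on it (jump, trace, lifting,
gradient, `B`) is bounded by the `L²(Ω)` norm (`tendsto_zero_of_injective`), and `u n → uh` carries
over to all of them. In particular `b n → 0`, whence `e n = b n - s n → 0`. The geometric part
ensures that the integrals are honest `L²` pairings: faces have finite surface measure, normals are
measurable, and the face weight is bounded. -/

theorem surf_lt_top_of_subset_hyperplane {N : ℕ} {s : Set (E N)} (hs : Bornology.IsBounded s)
    {c : E N} (hc : c ≠ 0) {a : ℝ} (hsa : s ⊆ {x | inner ℝ c x = a}) : surf N s < ⊤ := by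
  rcases s.eq_empty_or_nonempty with rfl | ⟨x₀, hx₀⟩
  · simp
  set K : Submodule ℝ (E N) := (ℝ ∙ c)ᗮ with hK
  -- Translated to the linear hyperplane `K`, the surface measure has full dimension, so it is
  -- finite on bounded sets.
  have hfin : Module.finrank ℝ K = N - 1 := by
    have h1 := Submodule.finrank_add_finrank_orthogonal (ℝ ∙ c)
    rw [finrank_span_singleton hc, finrank_euclideanSpace_fin, ← hK] at h1
    omega
  let f : K → E N := fun y => x₀ + y
  have hf : Isometry f := (IsometryEquiv.addLeft x₀).isometry.comp isometry_subtype_coe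
  have hrange : s ⊆ Set.range f := fun x hx => by
    refine ⟨⟨x - x₀, ?_⟩, by simp [f]⟩
    rw [hK, Submodule.mem_orthogonal_singleton_iff_inner_right, inner_sub_right, hsa hx, hsa hx₀,
      sub_self]
  have h2 : surf N s = μHE[N - 1] (f ⁻¹' s) := by
    rw [hf.euclideanHausdorffMeasure_preimage, Set.inter_eq_left.2 hrange]
  rw [h2, ← hfin]
  have hb : Bornology.IsBounded (f ⁻¹' s) := by
    obtain ⟨C, hC⟩ := Metric.isBounded_iff.1 hs
    exact Metric.isBounded_iff.2 ⟨C, fun x hx y hy => by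
      rw [← hf.dist_eq]; exact hC hx hy⟩
  exact hb.measure_lt_top

theorem IsConvexPolytope.isClosed {N : ℕ} {K : Set (E N)} (hK : IsConvexPolytope K) :
    IsClosed K := by
  obtain ⟨-, -, s, rfl⟩ := hK
  simp only [Set.ofPred_forall]
  exact isClosed_biInter fun c _ => isClosed_le (by fun_prop) continuous_const

theorem IsConvexPolytope.convex {N : ℕ} {K : Set (E N)} (hK : IsConvexPolytope K) :
    Convex ℝ K := by
  obtain ⟨-, -, s, rfl⟩ := hK
  simp only [Set.ofPred_forall]
  exact convex_iInter₂ fun c _ => convex_halfSpace_le (innerₛₗ ℝ c.1).isLinear c.2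

theorem IsConvexPolytope.surf_frontier_lt_top {N : ℕ} {K : Set (E N)} (hK : IsConvexPolytope K) :
    surf N (frontier K) < ⊤ := by
  classical
  have hcl := hK.isClosed
  obtain ⟨hb, -, s, hs⟩ := hK
  -- A boundary point makes some constraint active. Constraints with zero normal do not depend on
  -- the point and define no hyperplane, hence the filter.
  have hsub : frontier K ⊆ ⋃ c ∈ s.filter (fun c => c.1 ≠ 0), K ∩ {x | inner ℝ c.1 x = c.2} := by
    intro x hx
    have hxK : x ∈ K := hcl.frontier_subset hx
    by_contra hcon
    simp only [Set.mem_iUnion, Finset.mem_filter, not_exists] at hcon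
    refine hx.2 (mem_interior_iff_mem_nhds.2 ?_)
    have hev : ∀ᶠ y in 𝓝 x, ∀ c ∈ s, inner ℝ c.1 y ≤ c.2 := by
      rw [Filter.eventually_all_finset]
      intro c hc
      have hxc : inner ℝ c.1 x ≤ c.2 := by
        rw [hs] at hxK
        exact hxK c hc
      by_cases h0 : c.1 = 0
      · refine Eventually.of_forall fun y => ?_
        rw [h0, inner_zero_left] at hxc ⊢
        exact hxc
      · have hlt : inner ℝ c.1 x < c.2 :=
          lt_of_le_of_ne hxc fun h => hcon c ⟨hc, h0⟩ ⟨hxK, h⟩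
        have hcont : Continuous fun y : E N => inner ℝ c.1 y := by fun_prop
        exact (hcont.continuousAt.eventually_lt continuousAt_const hlt).mono fun y => le_of_lt
    rw [hs]
    exact hev
  refine (measure_mono hsub).trans_lt ((measure_biUnion_lt_top (Finset.finite_toSet _) ?_))
  intro c hc
  exact surf_lt_top_of_subset_hyperplane (hb.subset Set.inter_subset_left)
    (Finset.mem_filter.1 hc).2 Set.inter_subset_right

theorem IsPolyhedron.isClosed {N : ℕ} {κ : Set (E N)} (h : IsPolyhedron κ) : IsClosed κ := by
  obtain ⟨C, -, hC, rfl⟩ := h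
  exact isClosed_biUnion_finset fun K hK => (hC K hK).isClosed

theorem IsPolyhedron.isBounded {N : ℕ} {κ : Set (E N)} (h : IsPolyhedron κ) :
    Bornology.IsBounded κ := by
  obtain ⟨C, -, hC, rfl⟩ := h
  exact (Bornology.isBounded_biUnion_finset C).2 fun K hK => (hC K hK).1

theorem IsPolyhedron.nonempty_interior {N : ℕ} {κ : Set (E N)} (h : IsPolyhedron κ) :
    (interior κ).Nonempty := by
  obtain ⟨C, ⟨K, hK⟩, hC, rfl⟩ := h
  exact (hC K hK).2.1.mono (interior_mono (Set.subset_biUnion_of_mem (u := fun K => K) hK))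

/-- Each convex piece is the closure of its interior. This upgrades disjointness of the interiors of
two elements to disjointness of one interior from the whole other element. -/
theorem IsPolyhedron.subset_closure_interior {N : ℕ} {κ : Set (E N)} (h : IsPolyhedron κ) :
    κ ⊆ closure (interior κ) := by
  obtain ⟨C, -, hC, rfl⟩ := h
  refine Set.iUnion₂_subset fun K hK => ?_
  have h1 := (hC K hK).convex.closure_interior_eq_closure_of_nonempty_interior (hC K hK).2.1
  calc K ⊆ closure (interior K) := h1 ▸ subset_closure
    _ ⊆ _ := closure_mono (interior_mono (Set.subset_biUnion_of_mem (u := fun K => K) hK))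

theorem IsPolyhedron.surf_frontier_lt_top {N : ℕ} {κ : Set (E N)} (h : IsPolyhedron κ) :
    surf N (frontier κ) < ⊤ := by
  obtain ⟨C, -, hC, rfl⟩ := h
  have hsub : frontier (⋃ K ∈ C, K) ⊆ ⋃ K ∈ C, frontier K := by
    intro x hx
    have hcl : IsClosed (⋃ K ∈ C, K) := isClosed_biUnion_finset fun K hK => (hC K hK).isClosed
    obtain ⟨K, hK, hxK⟩ := Set.mem_iUnion₂.1 (hcl.frontier_subset hx)
    refine Set.mem_iUnion₂.2 ⟨K, hK, subset_closure hxK, fun hi => hx.2 ?_⟩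
    exact interior_mono (Set.subset_biUnion_of_mem (u := fun K => K) hK) hi
  exact (measure_mono hsub).trans_lt
    (measure_biUnion_lt_top C.finite_toSet fun K hK => (hC K hK).surf_frontier_lt_top)

theorem IsPolyhedralDomain.isBounded {N : ℕ} {Ω : Set (E N)} (h : IsPolyhedralDomain Ω) :
    Bornology.IsBounded Ω :=
  h.polyhedral.isBounded.subset subset_closure

theorem IsPolyhedralDomain.surf_frontier_lt_top {N : ℕ} {Ω : Set (E N)}
    (h : IsPolyhedralDomain Ω) : surf N (frontier Ω) < ⊤ := by
  have h1 : frontier Ω = frontier (closure Ω) := by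
    rw [frontier, frontier, closure_closure, h.regular, h.isOpen.interior_eq]
  rw [h1]
  exact h.polyhedral.surf_frontier_lt_top

/-! ### Outer normals -/

/-- Near `x` the set is a half-space, so a nearby `z` has a normal only on the bounding hyperplane:
strictly inside, a small move along the alleged normal `μ` stays in `κ`; strictly outside, `z`
itself would have to belong to `κ`. -/
theorem IsOuterNormal.eventually_mem_iff {N : ℕ} {κ : Set (E N)} {x ν : E N}
    (h : IsOuterNormal κ x ν) :
    ∀ᶠ z in 𝓝 x, (inner ℝ ν (z - x) = 0 → IsOuterNormal κ z ν) ∧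
      ((∃ μ, IsOuterNormal κ z μ) → inner ℝ ν (z - x) = 0) := by
  filter_upwards [h.2.eventually_nhds] with z hz
  refine ⟨fun h0 => ⟨h.1, ?_⟩, ?_⟩
  · filter_upwards [hz] with y hy
    rw [hy]
    have : inner ℝ ν (y - x) = inner ℝ ν (y - z) + inner ℝ ν (z - x) := by
      rw [← inner_add_right]
      congr 1
      abel
    rw [this, h0, add_zero]
  · rintro ⟨μ, hμ1, hμ⟩
    have hμ0 : inner ℝ μ μ = (1 : ℝ) := by rw [real_inner_self_eq_norm_sq, hμ1]; norm_num
    have hcont : Continuous fun y : E N => inner ℝ ν (y - x) := by fun_prop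
    have hline : Tendsto (fun t : ℝ => z + t • μ) (𝓝[>] 0) (𝓝 z) := by
      have : Continuous fun t : ℝ => z + t • μ := by fun_prop
      simpa using (this.tendsto 0).mono_left nhdsWithin_le_nhds
    have hpos : ∀ᶠ t : ℝ in 𝓝[>] 0, 0 < t := eventually_mem_nhdsWithin
    rcases lt_trichotomy (inner ℝ ν (z - x)) 0 with hlt | heq | hgt
    · exfalso
      have h1 : ∀ᶠ y in 𝓝 z, inner ℝ ν (y - x) < 0 :=
        hcont.continuousAt.eventually_lt continuousAt_const hlt
      obtain ⟨t, ⟨h2, h3⟩, ⟨h4, h5⟩⟩ := ((hline.eventually (hz.and hμ)).and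
        ((hline.eventually h1).and hpos)).exists
      have h6 := h3.1 (h2.2 h4.le)
      rw [add_sub_cancel_left, inner_smul_right, hμ0] at h6
      linarith
    · exact heq
    · exfalso
      have h1 : ∀ᶠ y in 𝓝 z, 0 < inner ℝ ν (y - x) :=
        continuousAt_const.eventually_lt hcont.continuousAt hgt
      have h2 := (hz.and (hμ.and h1)).self_of_nhds
      have h3 := h2.1.1 (h2.2.1.2 (by simp))
      linarith [h2.2.2]

theorem IsOuterNormal.unique {N : ℕ} {κ : Set (E N)} {x ν μ : E N}
    (hν : IsOuterNormal κ x ν) (hμ : IsOuterNormal κ x μ) : ν = μ := by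
  by_contra hne
  have hν0 : inner ℝ ν ν = (1 : ℝ) := by rw [real_inner_self_eq_norm_sq, hν.1]; norm_num
  have hμ0 : inner ℝ μ μ = (1 : ℝ) := by rw [real_inner_self_eq_norm_sq, hμ.1]; norm_num
  have hlt : inner ℝ ν μ < (1 : ℝ) := by
    have h1 : 0 < ‖ν - μ‖ ^ 2 := by
      have : 0 < ‖ν - μ‖ := norm_pos_iff.2 (sub_ne_zero.2 hne)
      positivity
    rw [norm_sub_sq_real, hν.1, hμ.1] at h1
    linarith
  -- Along `ν - μ` one leaves the half-space of `ν` and enters that of `μ`, although both describe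
  -- `κ` near `x`.
  have hline : Tendsto (fun t : ℝ => x + t • (ν - μ)) (𝓝[>] 0) (𝓝 x) := by
    have : Continuous fun t : ℝ => x + t • (ν - μ) := by fun_prop
    simpa using (this.tendsto 0).mono_left nhdsWithin_le_nhds
  have hpos : ∀ᶠ t : ℝ in 𝓝[>] 0, 0 < t := eventually_mem_nhdsWithin
  obtain ⟨t, ⟨h1, h2⟩, ht⟩ := ((hline.eventually (hν.2.and hμ.2)).and hpos).exists
  rw [add_sub_cancel_left, inner_smul_right, inner_sub_right] at h1 h2
  rw [hν0] at h1
  rw [hμ0, real_inner_comm] at h2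
  have h3 := h1.1 (h2.2 (by nlinarith))
  nlinarith

theorem IsOuterNormal.outerNormal_eq {N : ℕ} {κ : Set (E N)} {x ν : E N}
    (h : IsOuterNormal κ x ν) : outerNormal κ x = ν := by
  have hex : ∃ ν, IsOuterNormal κ x ν := ⟨ν, h⟩
  rw [outerNormal, dif_pos hex]
  exact hex.choose_spec.unique h

theorem norm_outerNormal_le {N : ℕ} (κ : Set (E N)) (x : E N) : ‖outerNormal κ x‖ ≤ 1 := by
  unfold outerNormal
  split_ifs with h
  · exact h.choose_spec.1.le
  · simp

/-- No regularity of `κ` is needed: the set `M` of points with a normal is locally a hyperplane,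
hence locally closed and so Borel, and the normal is locally constant on `M` and `0` off it. -/
theorem measurable_outerNormal {N : ℕ} (κ : Set (E N)) : Measurable (outerNormal κ) := by
  classical
  set M : Set (E N) := {x | ∃ ν, IsOuterNormal κ x ν} with hM
  have hMloc : IsLocallyClosed M := by
    refine ⟨⋃ (x) (ν) (_ : IsOuterNormal κ x ν),
      interior {z | (inner ℝ ν (z - x) = 0 → IsOuterNormal κ z ν) ∧ (z ∈ M → inner ℝ ν (z - x) = 0)},
      closure M, isOpen_iUnion fun x => isOpen_iUnion fun ν => isOpen_iUnion fun _ => isOpen_interior,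
      isClosed_closure, Set.Subset.antisymm ?_ ?_⟩
    · rintro x ⟨ν, hν⟩
      refine ⟨?_, subset_closure ⟨ν, hν⟩⟩
      simp only [Set.mem_iUnion]
      exact ⟨x, ν, hν, mem_interior_iff_mem_nhds.2 hν.eventually_mem_iff⟩
    · rintro z ⟨hzU, hzM⟩
      simp only [Set.mem_iUnion] at hzU
      obtain ⟨x, ν, -, hz⟩ := hzU
      refine ⟨ν, (interior_subset hz).1 ?_⟩
      have h1 : z ∈ closure (M ∩ interior {z | (inner ℝ ν (z - x) = 0 → IsOuterNormal κ z ν) ∧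
          (z ∈ M → inner ℝ ν (z - x) = 0)}) := by
        rw [Set.inter_comm]
        exact isOpen_interior.inter_closure ⟨hz, hzM⟩
      have h2 : IsClosed {z : E N | inner ℝ ν (z - x) = (0 : ℝ)} :=
        isClosed_eq (by fun_prop) continuous_const
      exact closure_minimal (fun y hy => (interior_subset hy.2).2 hy.1) h2 h1
  have hMmeas : MeasurableSet M := by
    obtain ⟨U, Z, hU, hZ, h⟩ := hMloc
    rw [h]
    exact hU.measurableSet.inter hZ.measurableSet
  have hcont : ContinuousOn (outerNormal κ) M := by
    rintro x ⟨ν, hν⟩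
    refine ContinuousWithinAt.congr_of_eventuallyEq (f := fun _ => ν) continuousWithinAt_const ?_
      hν.outerNormal_eq
    filter_upwards [mem_nhdsWithin_of_mem_nhds hν.eventually_mem_iff, self_mem_nhdsWithin]
      with z hz hzM
    exact (hz.1 (hz.2 hzM)).outerNormal_eq
  have h := ContinuousOn.measurable_piecewise (g := fun _ => (0 : E N)) hcont
    continuousOn_const hMmeas
  convert h using 1
  ext1 x
  by_cases hx : x ∈ M
  · rw [Set.piecewise_eq_of_mem _ _ _ hx]
  · rw [Set.piecewise_eq_of_notMem _ _ _ hx]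
    exact dif_neg hx

/-! ### The Uzawa-type iteration in an inner product space -/

theorem tendsto_zero_of_le_sub {x y : ℕ → ℝ} (hy : ∀ n, 0 ≤ y n) (hx : ∀ n, 0 ≤ x n)
    (h : ∀ n, x n ≤ y n - y (n + 1)) : Antitone y ∧ Tendsto x atTop (𝓝 0) := by
  have hanti : Antitone y := antitone_nat_of_succ_le fun n => by linarith [hx n, h n]
  have hlim := tendsto_atTop_ciInf hanti ⟨0, by rintro _ ⟨n, rfl⟩; exact hy n⟩
  refine ⟨hanti, squeeze_zero hx h ?_⟩
  simpa using hlim.sub (hlim.comp (tendsto_add_atTop_nat 1))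

/-- The margin equals `(r² + r ρ - ρ²) / r`, whose numerator has the roots `r (1 ± √5) / 2` in `ρ`.
-/
theorem stepSize_margin_pos {r ρ : ℝ} (hρ : 0 < ρ) (hρr : ρ < r * ((1 + √5) / 2)) :
    0 < r ∧ 0 < 2 * r - ρ - (r - ρ) ^ 2 / r := by
  have h5 : √5 ^ 2 = 5 := Real.sq_sqrt (by norm_num)
  have h50 : 0 ≤ √5 := Real.sqrt_nonneg 5
  have h51 : 1 < √5 := by nlinarith
  have hr : 0 < r := by
    by_contra hr
    have : r * ((1 + √5) / 2) ≤ 0 := mul_nonpos_of_nonpos_of_nonneg (not_lt.1 hr) (by positivity)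
    linarith
  refine ⟨hr, ?_⟩
  have h2 : 0 < (r * ((1 + √5) / 2) - ρ) * (ρ + r * ((√5 - 1) / 2)) :=
    mul_pos (by linarith) (by nlinarith [mul_pos hr (sub_pos.2 h51)])
  have h3 : 2 * r - ρ - (r - ρ) ^ 2 / r =
      (r * ((1 + √5) / 2) - ρ) * (ρ + r * ((√5 - 1) / 2)) / r := by
    rw [eq_div_iff hr.ne', sub_mul, div_mul_cancel₀ _ hr.ne']
    linear_combination (-r ^ 2 / 4) * h5
  rw [h3]
  exact div_pos h2 hr

/-- Primes denote the previous iterate. With `s = b - e` and `d = e - e'`, the sum of `h1` and `h2`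
controls `⟨L, s⟩` up to the term `r ⟨d, s⟩`. By `h3` this is at least `(r - ρ) ⟨s', d⟩`, and
completing the square absorbs it into `r ‖d‖²` at the price of `(r - ρ)² / r ‖s'‖²`, which is why
the energy contains the residual. -/
theorem lyapunov_step {X : Type*} [NormedAddCommGroup X] [InnerProductSpace ℝ X] {r ρ a : ℝ}
    (hr : 0 < r) (hρ : 0 < ρ) {L b e s' e' : X}
    (h1 : 2 * a ≤ -inner ℝ L b - r * inner ℝ (b - e') b)
    (h2 : 0 ≤ inner ℝ L e - r * inner ℝ (e - b) e)
    (h3 : 0 ≤ ρ * inner ℝ s' (e - e') + r * inner ℝ (b - e - s') (e - e')) :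
    ρ * (2 * r - ρ - (r - ρ) ^ 2 / r) * ‖b - e‖ ^ 2 + 4 * ρ * a ≤
      (‖L‖ ^ 2 + ρ * r * ‖e'‖ ^ 2 + ρ * ((r - ρ) ^ 2 / r) * ‖s'‖ ^ 2) -
      (‖L + ρ • (b - e)‖ ^ 2 + ρ * r * ‖e‖ ^ 2 + ρ * ((r - ρ) ^ 2 / r) * ‖b - e‖ ^ 2) := by
  obtain ⟨s, rfl⟩ : ∃ s, b = s + e := ⟨b - e, by abel⟩
  obtain ⟨d, rfl⟩ : ∃ d, e' = e - d := ⟨e - e', by abel⟩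
  have hsq : 0 ≤ ‖r • d + (r - ρ) • s'‖ ^ 2 := by positivity
  have hK : (r - ρ) ^ 2 = (r - ρ) ^ 2 / r * r := (div_mul_cancel₀ _ hr.ne').symm
  set K := (r - ρ) ^ 2 / r
  -- Each inner product is brought to one order of its arguments, so that the rest is linear in
  -- common atoms.
  simp only [add_sub_cancel_right, sub_sub_cancel, ← real_inner_self_eq_norm_sq, inner_add_left,
    inner_add_right, inner_sub_left, inner_sub_right, real_inner_smul_left,
    real_inner_smul_right, real_inner_comm L s, real_inner_comm s e, real_inner_comm s d,
    real_inner_comm e d, real_inner_comm s' d] at *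
  have h5 : 0 ≤ r * inner ℝ d d + 2 * (r - ρ) * inner ℝ s' d + K * inner ℝ s' s' := by
    refine nonneg_of_mul_nonneg_right (hsq.trans_eq ?_) hr
    linear_combination inner ℝ s' s' * hK
  have h6 := mul_nonneg hρ.le h5
  have h7 := mul_nonneg hρ.le (add_nonneg (sub_nonneg.2 h1) h2)
  have h8 := mul_nonneg hρ.le h3
  linarith

theorem augmented_lagrangian_convergence {X : Type*} [NormedAddCommGroup X]
    [InnerProductSpace ℝ X] {r ρ : ℝ}
    (hρ : 0 < ρ) (hρr : ρ < r * ((1 + √5) / 2)) {b e L : ℕ → X} {a : ℕ → ℝ} (ha : ∀ n, 0 ≤ a n)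
    (h1 : ∀ n, 1 ≤ n → 2 * a n ≤ -inner ℝ (L n) (b n) - r * inner ℝ (b n - e (n - 1)) (b n))
    (h2 : ∀ n, 1 ≤ n → 0 ≤ inner ℝ (L n) (e n) - r * inner ℝ (e n - b n) (e n))
    (h3 : ∀ n, 1 ≤ n → 0 ≤ inner ℝ (L (n + 1) - L n) (e (n + 1) - e n) +
      r * inner ℝ (b (n + 1) - e (n + 1) - (b n - e n)) (e (n + 1) - e n))
    (h4 : ∀ n, 1 ≤ n → L (n + 1) = L n + ρ • (b n - e n)) :
    Tendsto (fun n => b n - e n) atTop (𝓝 0) ∧ Tendsto a atTop (𝓝 0) ∧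
      ∃ C, ∀ n, 1 ≤ n → ‖L n‖ ≤ C := by
  obtain ⟨hr, hm⟩ := stepSize_margin_pos hρ hρr
  set m := 2 * r - ρ - (r - ρ) ^ 2 / r with hm_def
  -- The shift is forced: the comparison of consecutive `η`-steps starts with the pair `1, 2`, since
  -- `η 0` is arbitrary and satisfies no inequality.
  let y : ℕ → ℝ := fun n => ‖L (n + 2)‖ ^ 2 + ρ * r * ‖e (n + 1)‖ ^ 2 +
    ρ * ((r - ρ) ^ 2 / r) * ‖b (n + 1) - e (n + 1)‖ ^ 2
  let x : ℕ → ℝ := fun n => ρ * m * ‖b (n + 2) - e (n + 2)‖ ^ 2 + 4 * ρ * a (n + 2)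
  have hy : ∀ n, 0 ≤ y n := fun n => by positivity
  have hx : ∀ n, 0 ≤ x n := fun n => by have := ha (n + 2); positivity
  have hstep : ∀ n, x n ≤ y n - y (n + 1) := by
    intro n
    have h := lyapunov_step (s' := b (n + 1) - e (n + 1)) hr hρ (h1 (n + 2) (by omega))
      (h2 (n + 2) (by omega)) (by
        have h := h3 (n + 1) (by omega)
        rw [h4 (n + 1) (by omega), add_sub_cancel_left, real_inner_smul_left] at h
        exact h)
    rw [← h4 (n + 2) (by omega)] at h
    exact h
  obtain ⟨hanti, hx0⟩ := tendsto_zero_of_le_sub hy hx hstep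
  refine ⟨?_, ?_, ?_⟩
  · rw [← tendsto_add_atTop_iff_nat 2, tendsto_zero_iff_norm_tendsto_zero]
    have h5 : Tendsto (fun n => ‖b (n + 2) - e (n + 2)‖ ^ 2) atTop (𝓝 0) := by
      refine squeeze_zero (fun n => by positivity) (fun n => ?_)
        (by simpa only [mul_zero] using hx0.const_mul (ρ * m)⁻¹)
      rw [inv_mul_eq_div, le_div_iff₀ (by positivity)]
      have := mul_nonneg hρ.le (ha (n + 2))
      simp only [x]
      linarith
    simpa using h5.sqrt
  · rw [← tendsto_add_atTop_iff_nat 2]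
    refine squeeze_zero (fun n => ha _) (fun n => ?_)
      (by simpa only [mul_zero] using hx0.const_mul (4 * ρ)⁻¹)
    rw [inv_mul_eq_div, le_div_iff₀ (by positivity)]
    have : 0 ≤ ρ * m * ‖b (n + 2) - e (n + 2)‖ ^ 2 := by positivity
    simp only [x]
    linarith
  · refine ⟨max ‖L 1‖ √(y 0), fun n hn => ?_⟩
    rcases Nat.lt_or_ge n 2 with h | h
    · obtain rfl : n = 1 := by omega
      exact le_max_left _ _
    · obtain ⟨j, rfl⟩ := Nat.exists_eq_add_of_le' h
      refine le_max_of_le_right (Real.le_sqrt_of_sq_le ((?_ : _ ≤ y j).trans (hanti (Nat.zero_le j))))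
      have h6 : 0 ≤ ρ * r * ‖e (j + 1)‖ ^ 2 := by positivity
      have h7 : 0 ≤ ρ * ((r - ρ) ^ 2 / r) * ‖b (j + 1) - e (j + 1)‖ ^ 2 := by positivity
      simp only [y]
      linarith

/-! ### First variations along segments, and finite-dimensional comparison of norms. -/

theorem le_of_forall_segment {A D c : ℝ}
    (h : ∀ t : ℝ, 0 < t → t ≤ 1 → 0 ≤ t * A - t * (1 - t) * D + t ^ 2 * c) : D ≤ A := by
  -- Divide the hypothesis by `t` and let `t` decrease to `0`; the quadratic term `c` disappears.
  have hcont : Continuous fun t : ℝ => A - (1 - t) * D + t * c := by fun_prop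
  have hlim : Tendsto (fun t : ℝ => A - (1 - t) * D + t * c) (𝓝[>] 0) (𝓝 (A - D)) := by
    simpa using (hcont.tendsto 0).mono_left nhdsWithin_le_nhds
  refine sub_nonneg.1 (ge_of_tendsto hlim ?_)
  filter_upwards [Ioc_mem_nhdsGT (zero_lt_one' ℝ)] with t ht
  have h1 := h t ht.1 ht.2
  have h2 : t * A - t * (1 - t) * D + t ^ 2 * c = t * (A - (1 - t) * D + t * c) := by ring
  rw [h2] at h1
  exact nonneg_of_mul_nonneg_right h1 ht.1

/-- `V` needs no norm of its own: `A` factors through the finite-dimensional range of `J`, where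
every linear map is continuous. -/
theorem exists_norm_le_of_injective {V Y Z : Type*} [AddCommGroup V] [Module ℝ V]
    [FiniteDimensional ℝ V] [NormedAddCommGroup Y] [NormedSpace ℝ Y] [NormedAddCommGroup Z]
    [NormedSpace ℝ Z] (J : V →ₗ[ℝ] Y) (hJ : Function.Injective J) (A : V →ₗ[ℝ] Z) :
    ∃ C, ∀ v, ‖A v‖ ≤ C * ‖J v‖ := by
  let e := LinearEquiv.ofInjective J hJ
  let A' : LinearMap.range J →L[ℝ] Z := LinearMap.toContinuousLinearMap (A ∘ₗ e.symm.toLinearMap)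
  refine ⟨‖A'‖, fun v => ?_⟩
  have h := A'.le_opNorm (e v)
  simpa [A', e] using h

theorem tendsto_zero_of_injective {V Y Z : Type*} [AddCommGroup V] [Module ℝ V]
    [FiniteDimensional ℝ V] [NormedAddCommGroup Y] [NormedSpace ℝ Y] [NormedAddCommGroup Z]
    [NormedSpace ℝ Z] (J : V →ₗ[ℝ] Y) (hJ : Function.Injective J) (A : V →ₗ[ℝ] Z) {v : ℕ → V}
    (hv : Tendsto (fun n => ‖J (v n)‖) atTop (𝓝 0)) : Tendsto (fun n => A (v n)) atTop (𝓝 0) := by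
  obtain ⟨C, hC⟩ := exists_norm_le_of_injective J hJ A
  exact squeeze_zero_norm (fun n => hC (v n)) (by simpa using hv.const_mul C)

/-- A linear family of functions in `L^q(μ)`, as a linear map to `L^q(μ)`. -/
def toLpLinear {α V Y : Type*} [MeasurableSpace α] [AddCommGroup V] [Module ℝ V]
    [NormedAddCommGroup Y] [NormedSpace ℝ Y] (μ : Measure α) (q : ENNReal) (A : V →ₗ[ℝ] (α → Y))
    (hA : ∀ v, MemLp (A v) q μ) : V →ₗ[ℝ] Lp Y q μ where
  toFun v := (hA v).toLp
  map_add' v w := by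
    rw [← MemLp.toLp_add]
    exact MemLp.toLp_congr _ _ (by rw [map_add])
  map_smul' c v := by
    rw [RingHom.id_apply, ← MemLp.toLp_const_smul]
    exact MemLp.toLp_congr _ _ (by rw [map_smul])

section toLpLinear

variable {α V W Y : Type*} [MeasurableSpace α] [AddCommGroup V] [Module ℝ V] [AddCommGroup W]
  [Module ℝ W] [NormedAddCommGroup Y] {μ : Measure α}

theorem enorm_toLpLinear [NormedSpace ℝ Y] {q : ENNReal} (A : V →ₗ[ℝ] (α → Y))
    (hA : ∀ v, MemLp (A v) q μ) (v : V) : ‖toLpLinear μ q A hA v‖ₑ = eLpNorm (A v) q μ :=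
  Lp.enorm_toLp (hA v)

theorem inner_toLpLinear [InnerProductSpace ℝ Y] (A : V →ₗ[ℝ] (α → Y))
    (hA : ∀ v, MemLp (A v) 2 μ) (A' : W →ₗ[ℝ] (α → Y)) (hA' : ∀ v, MemLp (A' v) 2 μ) (v : V)
    (w : W) :
    inner ℝ (toLpLinear μ 2 A hA v) (toLpLinear μ 2 A' hA' w) =
      ∫ x, inner ℝ (A v x) (A' w x) ∂μ := by
  rw [L2.inner_def]
  refine integral_congr_ae ?_
  filter_upwards [(hA v).coeFn_toLp, (hA' w).coeFn_toLp] with x h1 h2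
  rw [← h1, ← h2]
  rfl

end toLpLinear

namespace Mesh

variable {N : ℕ} {Ω : Set (E N)} {T : Mesh Ω} {k l : ℕ}

/-! ### Geometry of meshes -/

theorem element_subset_closure {κ : Set (E N)} (hκ : κ ∈ T.elements) : κ ⊆ closure Ω := by
  rw [← T.cover]
  exact Set.subset_biUnion_of_mem (u := fun κ => κ) hκ

theorem interior_element_subset (hΩ : IsPolyhedralDomain Ω) {κ : Set (E N)}
    (hκ : κ ∈ T.elements) : interior κ ⊆ Ω := by
  rw [← hΩ.regular]
  exact interior_mono (element_subset_closure hκ)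

theorem disjoint_interior_element {κ κ' : Set (E N)} (hκ : κ ∈ T.elements)
    (hκ' : κ' ∈ T.elements) (hne : κ ≠ κ') : Disjoint (interior κ) κ' := by
  have h1 : Disjoint (interior κ) (closure (interior κ')) :=
    (T.disjoint κ hκ κ' hκ' hne).closure_right isOpen_interior
  exact h1.mono_right (T.polyhedral κ' hκ').subset_closure_interior

theorem finite_faces (T : Mesh Ω) : T.faces.Finite := by
  have h1 : (Set.image2 (fun κ κ' : Set (E N) => κ ∩ κ') T.elements T.elements ∪
      (fun κ : Set (E N) => κ ∩ frontier Ω) '' T.elements).Finite :=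
    (T.elements.finite_toSet.image2 _ T.elements.finite_toSet).union
      (T.elements.finite_toSet.image _)
  refine h1.subset ?_
  rintro e (⟨κ, hκ, κ', hκ', -, rfl, -⟩ | ⟨κ, hκ, rfl, -⟩)
  · exact Or.inl ⟨κ, hκ, κ', hκ', rfl⟩
  · exact Or.inr ⟨κ, hκ, rfl⟩

theorem isClosed_face {e : Set (E N)} (he : e ∈ T.faces) : IsClosed e := by
  rcases he with ⟨κ, hκ, κ', hκ', -, rfl, -⟩ | ⟨κ, hκ, rfl, -⟩
  · exact (T.polyhedral κ hκ).isClosed.inter (T.polyhedral κ' hκ').isClosed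
  · exact (T.polyhedral κ hκ).isClosed.inter isClosed_frontier

theorem face_subset_closure {e : Set (E N)} (he : e ∈ T.faces) : e ⊆ closure Ω := by
  rcases he with ⟨κ, hκ, κ', hκ', -, rfl, -⟩ | ⟨κ, hκ, rfl, -⟩
  · exact Set.inter_subset_left.trans (element_subset_closure hκ)
  · exact Set.inter_subset_left.trans (element_subset_closure hκ)

theorem surf_face_lt_top (hΩ : IsPolyhedralDomain Ω) {e : Set (E N)} (he : e ∈ T.faces) :
    surf N e < ⊤ := by
  rcases he with ⟨κ, hκ, κ', hκ', hne, rfl, -⟩ | ⟨κ, hκ, rfl, -⟩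
  · refine (measure_mono ?_).trans_lt (T.polyhedral κ hκ).surf_frontier_lt_top
    exact fun x hx => ⟨subset_closure hx.1, fun h =>
      (disjoint_interior_element hκ hκ' hne).notMem_of_mem_left h hx.2⟩
  · exact (measure_mono Set.inter_subset_right).trans_lt hΩ.surf_frontier_lt_top

theorem measurableSet_Γint (T : Mesh Ω) : MeasurableSet T.Γint :=
  (T.finite_faces.subset (Set.sep_subset _ _)).measurableSet_biUnion
    fun _ he => (isClosed_face he.1).measurableSet

theorem Γint_subset_closure (T : Mesh Ω) : T.Γint ⊆ closure Ω :=
  Set.iUnion₂_subset fun _ he => face_subset_closure he.1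

theorem surf_Γint_lt_top (hΩ : IsPolyhedralDomain Ω) (T : Mesh Ω) : surf N T.Γint < ⊤ :=
  measure_biUnion_lt_top (T.finite_faces.subset (Set.sep_subset _ _))
    fun _ he => surf_face_lt_top hΩ he.1

/-! ### Values, jumps -/

theorem piece_add (v w : T.S k) (κ : {κ // κ ∈ T.elements}) (x : E N) :
    piece (v + w) κ x = piece v κ x + piece w κ x := by
  simp [piece]

theorem piece_smul (c : ℝ) (v : T.S k) (κ : {κ // κ ∈ T.elements}) (x : E N) :
    piece (c • v) κ x = c * piece v κ x := by
  simp [piece]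

/-- `val` as a linear map. -/
def valLin (T : Mesh Ω) (k : ℕ) : T.S k →ₗ[ℝ] (E N → ℝ) where
  toFun v := val v
  map_add' v w := by
    ext x
    simp only [val, piece_add, Finset.sum_add_distrib, Pi.add_apply, mul_add]
  map_smul' c v := by
    ext x
    simp only [val, piece_smul, ← Finset.mul_sum, Pi.smul_apply, smul_eq_mul, RingHom.id_apply]
    ring

/-- `vval` as a linear map. -/
def vvalLin (T : Mesh Ω) (l : ℕ) : T.H l →ₗ[ℝ] (E N → E N) where
  toFun q := vval q
  map_add' q w := by
    ext x i
    exact congrFun ((valLin T l).map_add (q i) (w i)) x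
  map_smul' c q := by
    ext x i
    exact congrFun ((valLin T l).map_smul c (q i)) x

/-- `jump` as a linear map. -/
def jumpLin (T : Mesh Ω) (k : ℕ) : T.S k →ₗ[ℝ] (E N → E N) where
  toFun v := jump v
  map_add' v w := by
    ext1 x
    simp only [jump, piece_add, Finset.sum_add_distrib, Pi.add_apply, add_smul]
  map_smul' c v := by
    ext1 x
    simp only [jump, piece_smul, Finset.smul_sum, Pi.smul_apply, mul_smul, RingHom.id_apply]

theorem continuous_piece (v : T.S k) (κ : {κ // κ ∈ T.elements}) : Continuous (piece v κ) :=
  (MvPolynomial.continuous_eval _).comp (by fun_prop : Continuous fun x : E N => fun i => x i)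

theorem sum_at_eq_sum_indicator {M : Type*} [AddCommMonoid M]
    (f : {κ // κ ∈ T.elements} → E N → M) (x : E N) :
    ∑ κ ∈ T.at_ x, f κ x = ∑ κ : {κ // κ ∈ T.elements}, κ.1.indicator (f κ) x := by
  classical
  rw [at_, Finset.sum_filter]
  exact Finset.sum_congr rfl fun κ _ => by simp [Set.indicator_apply]

theorem measurableSet_element (κ : {κ // κ ∈ T.elements}) : MeasurableSet κ.1 :=
  (T.polyhedral κ.1 κ.2).isClosed.measurableSet

theorem measurable_val (v : T.S k) : Measurable (val v) := by
  have h1 : val v = fun x => ((∑ κ : {κ // κ ∈ T.elements}, κ.1.indicator (fun _ => (1 : ℝ)) x))⁻¹ *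
      ∑ κ : {κ // κ ∈ T.elements}, κ.1.indicator (piece v κ) x := by
    ext x
    rw [← sum_at_eq_sum_indicator (fun _ _ => (1 : ℝ)), ← sum_at_eq_sum_indicator (piece v), val]
    simp
  rw [h1]
  refine Measurable.mul (Measurable.inv ?_) ?_
  · exact Finset.measurable_fun_sum _ fun κ _ =>
      measurable_const.indicator (measurableSet_element κ)
  · exact Finset.measurable_fun_sum _ fun κ _ =>
      (continuous_piece v κ).measurable.indicator (measurableSet_element κ)

theorem measurable_vval (q : T.H l) : Measurable (vval q) :=
  (WithLp.measurable_toLp 2 (Fin N → ℝ)).comp (measurable_pi_lambda _ fun i => measurable_val (q i))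

theorem measurable_jump (v : T.S k) : Measurable (jump v) := by
  have h1 : jump v = fun x => ∑ κ : {κ // κ ∈ T.elements},
      κ.1.indicator (fun x => piece v κ x • outerNormal κ.1 x) x := by
    ext1 x
    rw [← sum_at_eq_sum_indicator fun κ x => piece v κ x • outerNormal κ.1 x, jump]
  rw [h1]
  exact Finset.measurable_fun_sum _ fun κ _ =>
    ((continuous_piece v κ).measurable.smul (measurable_outerNormal κ.1)).indicator
      (measurableSet_element κ)

theorem exists_sum_piece_le (hΩ : IsPolyhedralDomain Ω) (v : T.S k) :
    ∃ C, ∀ x ∈ closure Ω, ∑ κ ∈ T.at_ x, |piece v κ x| ≤ C := by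
  classical
  have hcont : Continuous fun x => ∑ κ : {κ // κ ∈ T.elements}, |piece v κ x| :=
    continuous_finsetSum _ fun κ _ => (continuous_piece v κ).abs
  obtain ⟨C, hC⟩ := (hΩ.isBounded.isCompact_closure.image hcont).isBounded.bddAbove
  refine ⟨C, fun x hx => le_trans ?_ (hC ⟨x, hx, rfl⟩)⟩
  exact Finset.sum_le_sum_of_subset_of_nonneg (Finset.subset_univ _) fun _ _ _ => abs_nonneg _

theorem exists_abs_val_le (hΩ : IsPolyhedralDomain Ω) (v : T.S k) :
    ∃ C, ∀ x ∈ closure Ω, ‖val v x‖ ≤ C := by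
  obtain ⟨C, hC⟩ := exists_sum_piece_le hΩ v
  refine ⟨C, fun x hx => le_trans ?_ (hC x hx)⟩
  have h1 : ‖((T.at_ x).card : ℝ)⁻¹‖ ≤ 1 := by
    rw [Real.norm_eq_abs, abs_inv, Nat.abs_cast]
    exact Nat.cast_inv_le_one _
  rw [val, norm_mul]
  exact (mul_le_of_le_one_left (norm_nonneg _) h1).trans (Finset.abs_sum_le_sum_abs _ _)

theorem exists_norm_vval_le (hΩ : IsPolyhedralDomain Ω) (q : T.H l) :
    ∃ C, ∀ x ∈ closure Ω, ‖vval q x‖ ≤ C := by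
  choose C hC using fun i => exists_abs_val_le hΩ (q i)
  refine ⟨√(∑ i, C i ^ 2), fun x hx => ?_⟩
  rw [EuclideanSpace.norm_eq]
  refine Real.sqrt_le_sqrt (Finset.sum_le_sum fun i _ => ?_)
  exact pow_le_pow_left₀ (norm_nonneg _) (hC i x hx) 2

theorem exists_norm_jump_le (hΩ : IsPolyhedralDomain Ω) (v : T.S k) :
    ∃ C, ∀ x ∈ closure Ω, ‖jump v x‖ ≤ C := by
  obtain ⟨C, hC⟩ := exists_sum_piece_le hΩ v
  refine ⟨C, fun x hx => le_trans ?_ (hC x hx)⟩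
  refine norm_sum_le_of_le _ fun κ _ => ?_
  rw [norm_smul]
  exact mul_le_of_le_one_right (norm_nonneg _) (norm_outerNormal_le _ _)

/-- Serves `Ω`, `∂Ω` and `Γ_int` alike: all lie in `closure Ω` and have finite measure. -/
theorem memLp_of_bound_closure {Y : Type*} [NormedAddCommGroup Y] [MeasurableSpace Y]
    [BorelSpace Y] [SecondCountableTopology Y] {q : ENNReal} {f : E N → Y} (hf : Measurable f)
    (hb : ∃ C, ∀ x ∈ closure Ω, ‖f x‖ ≤ C) {μ : Measure (E N)} {s : Set (E N)}
    (hs : MeasurableSet s) (hsΩ : s ⊆ closure Ω) (hμ : μ s < ⊤) : MemLp f q (μ.restrict s) := by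
  obtain ⟨C, hC⟩ := hb
  have : IsFiniteMeasure (μ.restrict s) := ⟨by simpa using hμ⟩
  refine MemLp.of_bound hf.aestronglyMeasurable C ?_
  filter_upwards [ae_restrict_mem hs] with x hx using hC x (hsΩ hx)

theorem volume_lt_top (hΩ : IsPolyhedralDomain Ω) : volume Ω < ⊤ :=
  hΩ.isBounded.measure_lt_top

theorem val_eq_piece {v : T.S k} (κ : {κ // κ ∈ T.elements}) {x : E N} (hx : x ∈ interior κ.1) :
    val v x = piece v κ x := by
  classical
  have h1 : T.at_ x = {κ} := by
    ext κ'
    simp only [at_, Finset.mem_filter, Finset.mem_univ, true_and, Finset.mem_singleton]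
    refine ⟨fun h => ?_, fun h => h ▸ interior_subset hx⟩
    by_contra hne
    exact (disjoint_interior_element κ.2 κ'.2 fun h' => hne (Subtype.ext h'.symm)).notMem_of_mem_left
      hx h
  simp [val, h1]

/-- On the interior of an element `val v` is a single polynomial; continuity makes it vanish there
everywhere, and the identity theorem makes it the zero polynomial. -/
theorem eq_zero_of_val_ae_eq_zero (hΩ : IsPolyhedralDomain Ω) {v : T.S k}
    (h : val v =ᵐ[volume.restrict Ω] 0) : v = 0 := by
  funext κ
  refine Subtype.ext ?_
  have hcont : Continuous fun x : Fin N → ℝ => MvPolynomial.eval x (v κ : MvPolynomial (Fin N) ℝ) :=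
    MvPolynomial.continuous_eval _
  have h1 : ∀ x ∈ interior κ.1, piece v κ x = 0 := by
    have h2 : piece v κ =ᵐ[volume.restrict (interior κ.1)] fun _ => (0 : ℝ) := by
      filter_upwards [ae_restrict_of_ae_restrict_of_subset (interior_element_subset hΩ κ.2) h,
        ae_restrict_mem isOpen_interior.measurableSet] with x hx hxκ
      rw [← val_eq_piece κ hxκ, hx]
      rfl
    exact Measure.eqOn_open_of_ae_eq h2 isOpen_interior (continuous_piece v κ).continuousOn
      continuousOn_const
  obtain ⟨x₀, hx₀⟩ := (T.polyhedral κ.1 κ.2).nonempty_interior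
  have h3 : ∀ᶠ y : Fin N → ℝ in 𝓝 (WithLp.ofLp x₀),
      MvPolynomial.eval y (v κ : MvPolynomial (Fin N) ℝ) = 0 := by
    have h4 : Tendsto (fun y : Fin N → ℝ => (WithLp.toLp 2 y : E N)) (𝓝 (WithLp.ofLp x₀)) (𝓝 x₀) :=
      (PiLp.continuous_toLp 2 (fun _ : Fin N => ℝ)).continuousAt
    filter_upwards [h4.eventually (isOpen_interior.mem_nhds hx₀)] with y hy
    exact h1 _ hy
  have h5 := (AnalyticOnNhd.eval_mvPolynomial (𝕜 := ℝ)
    (v κ : MvPolynomial (Fin N) ℝ)).eq_of_eventuallyEq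
    (analyticOnNhd_const (v := (0 : ℝ))) h3
  exact MvPolynomial.funext fun x => by simpa using congrFun h5 x

/-! ### Embeddings of the discrete spaces in `L²`. -/

theorem memLp_val (hΩ : IsPolyhedralDomain Ω) (v : T.S k) :
    MemLp (valLin T k v) 2 (volume.restrict Ω) :=
  memLp_of_bound_closure (measurable_val v) (exists_abs_val_le hΩ v) hΩ.isOpen.measurableSet
    subset_closure (volume_lt_top hΩ)

theorem memLp_trace (hΩ : IsPolyhedralDomain Ω) (v : T.S k) :
    MemLp (valLin T k v) 2 ((surf N).restrict (frontier Ω)) :=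
  memLp_of_bound_closure (measurable_val v) (exists_abs_val_le hΩ v)
    isClosed_frontier.measurableSet frontier_subset_closure hΩ.surf_frontier_lt_top

theorem memLp_jump (hΩ : IsPolyhedralDomain Ω) (v : T.S k) :
    MemLp (jumpLin T k v) 2 ((surf N).restrict T.Γint) :=
  memLp_of_bound_closure (measurable_jump v) (exists_norm_jump_le hΩ v) T.measurableSet_Γint
    T.Γint_subset_closure (surf_Γint_lt_top hΩ T)

theorem memLp_vval (hΩ : IsPolyhedralDomain Ω) (q : T.H l) :
    MemLp (vvalLin T l q) 2 (volume.restrict Ω) :=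
  memLp_of_bound_closure (measurable_vval q) (exists_norm_vval_le hΩ q) hΩ.isOpen.measurableSet
    subset_closure (volume_lt_top hΩ)

theorem memLp_average (hΩ : IsPolyhedralDomain Ω) (q : T.H l) :
    MemLp (vvalLin T l q) 2 ((surf N).restrict T.Γint) :=
  memLp_of_bound_closure (measurable_vval q) (exists_norm_vval_le hΩ q) T.measurableSet_Γint
    T.Γint_subset_closure (surf_Γint_lt_top hΩ T)

/-- The embedding of `S^k(T)` in `L²(Ω)`. -/
def toL2 (hΩ : IsPolyhedralDomain Ω) (T : Mesh Ω) (k : ℕ) :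
    T.S k →ₗ[ℝ] Lp ℝ 2 (volume.restrict Ω) :=
  toLpLinear _ 2 (valLin T k) (memLp_val hΩ)

/-- The trace map from `S^k(T)` to `L²(∂Ω)`. -/
def traceL2 (hΩ : IsPolyhedralDomain Ω) (T : Mesh Ω) (k : ℕ) :
    T.S k →ₗ[ℝ] Lp ℝ 2 ((surf N).restrict (frontier Ω)) :=
  toLpLinear _ 2 (valLin T k) (memLp_trace hΩ)

/-- The jump map from `S^k(T)` to `L²(Γ_int)`. -/
def jumpL2 (hΩ : IsPolyhedralDomain Ω) (T : Mesh Ω) (k : ℕ) :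
    T.S k →ₗ[ℝ] Lp (E N) 2 ((surf N).restrict T.Γint) :=
  toLpLinear _ 2 (jumpLin T k) (memLp_jump hΩ)

/-- The embedding of `S^l(T)^N` in `L²(Ω)^N`. -/
def vtoL2 (hΩ : IsPolyhedralDomain Ω) (T : Mesh Ω) (l : ℕ) :
    T.H l →ₗ[ℝ] Lp (E N) 2 (volume.restrict Ω) :=
  toLpLinear _ 2 (vvalLin T l) (memLp_vval hΩ)

/-- The averages on `Γ_int` of functions in `S^l(T)^N`, as elements of `L²(Γ_int)`. -/
def averageL2 (hΩ : IsPolyhedralDomain Ω) (T : Mesh Ω) (l : ℕ) :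
    T.H l →ₗ[ℝ] Lp (E N) 2 ((surf N).restrict T.Γint) :=
  toLpLinear _ 2 (vvalLin T l) (memLp_average hΩ)

theorem normV_eq (hΩ : IsPolyhedralDomain Ω) (v : T.S k) : normV v = ‖toL2 hΩ T k v‖ₑ :=
  (enorm_toLpLinear (valLin T k) (memLp_val hΩ) v).symm

theorem normBdry_eq (hΩ : IsPolyhedralDomain Ω) (v : T.S k) : normBdry v = ‖traceL2 hΩ T k v‖ₑ :=
  (enorm_toLpLinear (valLin T k) (memLp_trace hΩ) v).symm

theorem normJump_eq (hΩ : IsPolyhedralDomain Ω) (v : T.S k) : normJump v = ‖jumpL2 hΩ T k v‖ₑ :=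
  (enorm_toLpLinear (jumpLin T k) (memLp_jump hΩ) v).symm

theorem normH_eq (hΩ : IsPolyhedralDomain Ω) (q : T.H l) : normH q = ‖vtoL2 hΩ T l q‖ₑ :=
  (enorm_toLpLinear (vvalLin T l) (memLp_vval hΩ) q).symm

theorem innerH_eq (hΩ : IsPolyhedralDomain Ω) (q w : T.H l) :
    innerH q w = inner ℝ (vtoL2 hΩ T l q) (vtoL2 hΩ T l w) :=
  (inner_toLpLinear (vvalLin T l) (memLp_vval hΩ) (vvalLin T l) (memLp_vval hΩ) q w).symm

theorem integral_jump_eq (hΩ : IsPolyhedralDomain Ω) (v : T.S k) (q : T.H l) :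
    ∫ x in T.Γint, inner ℝ (jump v x) (vval q x) ∂(surf N) =
      inner ℝ (jumpL2 hΩ T k v) (averageL2 hΩ T l q) :=
  (inner_toLpLinear (jumpLin T k) (memLp_jump hΩ) (vvalLin T l) (memLp_average hΩ) v q).symm

theorem toL2_injective (hΩ : IsPolyhedralDomain Ω) : Function.Injective (toL2 hΩ T k) := by
  rw [injective_iff_map_eq_zero]
  intro v hv
  have h1 : eLpNorm (val v) 2 (volume.restrict Ω) = 0 := by
    rw [← normV, normV_eq hΩ, hv, enorm_zero]
  rw [eLpNorm_eq_zero_iff (measurable_val v).aestronglyMeasurable (by norm_num)] at h1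
  exact eq_zero_of_val_ae_eq_zero hΩ h1

theorem vtoL2_injective (hΩ : IsPolyhedralDomain Ω) : Function.Injective (vtoL2 hΩ T l) := by
  rw [injective_iff_map_eq_zero]
  intro q hq
  have h1 : eLpNorm (vval q) 2 (volume.restrict Ω) = 0 := by
    rw [← normH, normH_eq hΩ, hq, enorm_zero]
  rw [eLpNorm_eq_zero_iff (measurable_vval q).aestronglyMeasurable (by norm_num)] at h1
  funext i
  refine eq_zero_of_val_ae_eq_zero hΩ ?_
  filter_upwards [h1] with x hx
  exact congrArg (fun y : E N => y i) hx

/-! ### The lifting -/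

/-- `innerH` as a bilinear form. -/
def innerHForm (hΩ : IsPolyhedralDomain Ω) (T : Mesh Ω) (l : ℕ) : LinearMap.BilinForm ℝ (T.H l) :=
  (innerₗ (Lp (E N) 2 (volume.restrict Ω))).compl₁₂ (vtoL2 hΩ T l) (vtoL2 hΩ T l)

theorem innerHForm_apply (hΩ : IsPolyhedralDomain Ω) (q w : T.H l) :
    innerHForm hΩ T l q w = innerH q w :=
  (innerH_eq hΩ q w).symm

theorem eq_of_forall_innerH_eq (hΩ : IsPolyhedralDomain Ω) {q w : T.H l}
    (h : ∀ φ : T.H l, innerH q φ = innerH w φ) : q = w := by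
  refine vtoL2_injective hΩ (sub_eq_zero.1 (inner_self_eq_zero (𝕜 := ℝ).1 ?_))
  rw [← map_sub, map_sub, inner_sub_left, ← map_sub, ← innerH_eq, ← innerH_eq, h, sub_self]

theorem innerHForm_nondegenerate (hΩ : IsPolyhedralDomain Ω) :
    (innerHForm hΩ T l).Nondegenerate := by
  refine ⟨fun q hq => ?_, fun q hq => ?_⟩
  all_goals
    have h1 := hq q
    rw [innerHForm_apply, innerH_eq hΩ, inner_self_eq_zero] at h1
    exact vtoL2_injective hΩ (h1.trans (map_zero _).symm)

/-- Existence is the Riesz representation in finite dimension. Together with the uniqueness in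
`eq_of_forall_innerH_eq` it makes the chosen lifting linear in `v`. -/
theorem isLifting_lift (hΩ : IsPolyhedralDomain Ω) (v : T.S k) : IsLifting v (lift l v) := by
  refine Classical.epsilon_spec (p := IsLifting v)
    ⟨((innerHForm hΩ T l).toDual (innerHForm_nondegenerate hΩ)).symm
      (-(innerₗ _ (jumpL2 hΩ T k v) ∘ₗ averageL2 hΩ T l)), fun φ => ?_⟩
  rw [integral_jump_eq hΩ, ← innerHForm_apply hΩ, LinearMap.BilinForm.apply_toDual_symm_apply]
  rfl

/-- The lifting as a linear map. -/
def liftLin (hΩ : IsPolyhedralDomain Ω) (T : Mesh Ω) (k l : ℕ) : T.S k →ₗ[ℝ] T.H l where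
  toFun v := lift l v
  map_add' v w := by
    refine eq_of_forall_innerH_eq hΩ fun φ => ?_
    rw [isLifting_lift hΩ, innerH_eq hΩ, map_add, inner_add_left, ← innerH_eq, ← innerH_eq,
      isLifting_lift hΩ v, isLifting_lift hΩ w, integral_jump_eq hΩ, integral_jump_eq hΩ,
      integral_jump_eq hΩ, map_add, inner_add_left]
    ring
  map_smul' c v := by
    refine eq_of_forall_innerH_eq hΩ fun φ => ?_
    rw [isLifting_lift hΩ, innerH_eq hΩ, map_smul, real_inner_smul_left, ← innerH_eq,
      isLifting_lift hΩ v, integral_jump_eq hΩ, integral_jump_eq hΩ, map_smul,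
      real_inner_smul_left]
    simp

/-- The elementwise gradient as a linear map. -/
def gradLin (T : Mesh Ω) (hkl : k ≤ l + 1) : T.S k →ₗ[ℝ] T.H l where
  toFun v := grad hkl v
  map_add' v w := by
    funext i κ
    exact Subtype.ext (by simp [grad])
  map_smul' c v := by
    funext i κ
    exact Subtype.ext (by simp [grad])

/-- `B` as a linear map. -/
def BLin (hΩ : IsPolyhedralDomain Ω) (T : Mesh Ω) (hkl : k ≤ l + 1) : T.S k →ₗ[ℝ] T.H l :=
  liftLin hΩ T k l + gradLin T hkl

theorem BLin_apply (hΩ : IsPolyhedralDomain Ω) (hkl : k ≤ l + 1) (v : T.S k) :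
    BLin hΩ T hkl v = B hkl v :=
  rfl

end Mesh

/-! ### Continuity of the exponent, and convexity of powers of the norm. -/

theorem LogHolderOn.continuousOn {N : ℕ} {α : E N → ℝ} {s : Set (E N)} (h : LogHolderOn α s) :
    ContinuousOn α s := by
  obtain ⟨C, hC⟩ := h
  intro x hx
  -- The neighbourhood is punctured because at `y = x` the convention `1 / 0 = 0` turns the modulus
  -- into `C`.
  have h1 : Tendsto (fun y : E N => C / Real.log (Real.exp 1 + 1 / ‖y - x‖)) (𝓝[≠] x) (𝓝 0) := by
    refine Tendsto.const_div_atTop ?_ C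
    refine Real.tendsto_log_atTop.comp (tendsto_atTop_add_const_left _ _ ?_)
    simp only [one_div]
    refine Tendsto.comp tendsto_inv_nhdsGT_zero (tendsto_nhdsWithin_iff.2 ⟨?_, ?_⟩)
    · have : Continuous fun y : E N => ‖y - x‖ := by fun_prop
      simpa using (this.tendsto x).mono_left nhdsWithin_le_nhds
    · filter_upwards [self_mem_nhdsWithin] with y hy
      exact norm_pos_iff.2 (sub_ne_zero.2 hy)
  rw [← continuousWithinAt_sdiff_self]
  refine tendsto_iff_norm_sub_tendsto_zero.2 (squeeze_zero' (Eventually.of_forall fun _ => norm_nonneg _)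
    ?_ (h1.mono_left (nhdsWithin_mono x fun y hy => hy.2)))
  filter_upwards [self_mem_nhdsWithin] with y hy
  exact hC y hy.1 x hx

theorem sq_norm_segment {Y : Type*} [NormedAddCommGroup Y] [InnerProductSpace ℝ Y] (a b : Y)
    (t : ℝ) : ‖a + t • (b - a)‖ ^ 2 =
      (1 - t) * ‖a‖ ^ 2 + t * ‖b‖ ^ 2 - t * (1 - t) * ‖b - a‖ ^ 2 := by
  rw [norm_add_sq_real, norm_sub_sq_real, norm_smul, real_inner_smul_right, inner_sub_right,
    real_inner_self_eq_norm_sq, real_inner_comm, mul_pow, norm_sub_sq_real, Real.norm_eq_abs, sq_abs]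
  ring

theorem norm_rpow_segment_le {Y : Type*} [NormedAddCommGroup Y] [NormedSpace ℝ Y] (a b : Y)
    {t s : ℝ} (ht : 0 ≤ t) (ht1 : t ≤ 1) (hs : 1 ≤ s) :
    ‖a + t • (b - a)‖ ^ s ≤ (1 - t) * ‖a‖ ^ s + t * ‖b‖ ^ s := by
  have h1 : a + t • (b - a) = (1 - t) • a + t • b := by
    rw [smul_sub, sub_smul, one_smul]
    abel
  have h2 : ‖a + t • (b - a)‖ ≤ (1 - t) * ‖a‖ + t * ‖b‖ := by
    rw [h1]
    refine (norm_add_le _ _).trans_eq ?_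
    rw [norm_smul, norm_smul, Real.norm_of_nonneg ht, Real.norm_of_nonneg (sub_nonneg.2 ht1)]
  refine (Real.rpow_le_rpow (norm_nonneg _) h2 (by linarith)).trans ?_
  exact (convexOn_rpow hs).2 (norm_nonneg a) (norm_nonneg b) (sub_nonneg.2 ht1) ht (by ring)

namespace Mesh

variable {N : ℕ} {Ω : Set (E N)} {T : Mesh Ω} {k l : ℕ}

theorem val_segment (u v : T.S k) (t : ℝ) (x : E N) :
    val (u + t • (v - u)) x = val u x + t * (val v x - val u x) := by
  have h : valLin T k (u + t • (v - u)) = valLin T k u + t • (valLin T k v - valLin T k u) := by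
    rw [map_add, map_smul, map_sub]
  exact congrFun h x

theorem jump_segment (u v : T.S k) (t : ℝ) (x : E N) :
    jump (u + t • (v - u)) x = jump u x + t • (jump v x - jump u x) := by
  have h : jumpLin T k (u + t • (v - u)) =
      jumpLin T k u + t • (jumpLin T k v - jumpLin T k u) := by
    rw [map_add, map_smul, map_sub]
  exact congrFun h x

theorem vval_segment (q w : T.H l) (t : ℝ) (x : E N) :
    vval (q + t • (w - q)) x = vval q x + t • (vval w x - vval q x) := by
  have h : vvalLin T l (q + t • (w - q)) =
      vvalLin T l q + t • (vvalLin T l w - vvalLin T l q) := by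
    rw [map_add, map_smul, map_sub]
  exact congrFun h x

/-! ### The weight -/

theorem hloc_nonneg (T : Mesh Ω) (x : E N) : 0 ≤ T.hloc x :=
  Real.sSup_nonneg (by rintro _ ⟨e, -, rfl⟩; exact Metric.diam_nonneg)

/-- The value of `hloc` depends only on which of the finitely many closed faces contain the point;
this yields both measurability and finite range. -/
theorem exists_measurable_factor_hloc (T : Mesh Ω) :
    ∃ (ι : Type) (_ : Finite ι) (g : (ι → Prop) → ℝ) (f : E N → ι → Prop),
      Measurable f ∧ T.hloc = g ∘ f := by
  obtain ⟨n, φ, hφ⟩ := T.finite_faces.fin_param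
  refine ⟨Fin n, inferInstance, fun P => sSup (Metric.diam '' (φ '' {i | P i})),
    fun x i => x ∈ φ i, ?_, ?_⟩
  · refine measurable_pi_lambda _ fun i => measurableSet_setOfPred.1 ?_
    have : φ i ∈ T.faces := by rw [← hφ.2]; exact ⟨i, rfl⟩
    exact (isClosed_face this).measurableSet
  · ext x
    simp only [hloc, Function.comp_apply]
    congr 2
    ext e
    rw [← hφ.2]
    constructor
    · rintro ⟨⟨i, rfl⟩, hx⟩
      exact ⟨i, hx, rfl⟩
    · rintro ⟨i, hx, rfl⟩
      exact ⟨⟨i, rfl⟩, hx⟩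

theorem measurable_hloc (T : Mesh Ω) : Measurable T.hloc := by
  obtain ⟨ι, _, g, f, hf, h⟩ := T.exists_measurable_factor_hloc
  rw [h]
  exact Measurable.comp (measurable_of_finite g) hf

theorem finite_range_hloc (T : Mesh Ω) : (Set.range T.hloc).Finite := by
  obtain ⟨ι, _, g, f, -, h⟩ := T.exists_measurable_factor_hloc
  rw [h]
  exact (Set.finite_range g).subset (Set.range_comp_subset_range f g)

theorem exists_weight_le (T : Mesh Ω) {p : E N → ℝ} {s : Set (E N)}
    (hp : ∀ x ∈ s, 1 < p x ∧ p x ≤ 2) :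
    ∃ C, ∀ x ∈ s, ‖T.hloc x ^ (-2 / conj p x)‖ ≤ C := by
  -- For `1 < p ≤ 2` the exponent `-2 / p'` lies in `[-1, 0]`, so the weight is at most `1 + h⁻¹`.
  -- This includes `h = 0`, where `h⁻¹ = 0` and the power is at most `1`.
  obtain ⟨C, hC⟩ := (T.finite_range_hloc.image fun h => 1 + h⁻¹).bddAbove
  refine ⟨C, fun x hx => le_trans ?_ (hC ⟨_, ⟨x, rfl⟩, rfl⟩)⟩
  obtain ⟨h1, h2⟩ := hp x hx
  have hy : -2 / conj p x = -(2 * (p x - 1) / p x) := by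
    rw [conj]
    field_simp
  have hy0 : 0 ≤ 2 * (p x - 1) / p x := div_nonneg (by linarith) (by linarith)
  have hy1 : 2 * (p x - 1) / p x ≤ 1 := by
    rw [div_le_one (by linarith)]
    linarith
  have h0 := T.hloc_nonneg x
  rw [hy, Real.norm_of_nonneg (Real.rpow_nonneg h0 _)]
  generalize 2 * (p x - 1) / p x = y at hy0 hy1
  generalize T.hloc x = h at h0
  dsimp only
  rcases h0.eq_or_lt with rfl | hpos
  · rw [inv_zero, add_zero]
    exact Real.zero_rpow_le_one _
  · rcases le_total 1 h with h3 | h3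
    · have h4 : h ^ (-y) ≤ 1 := Real.rpow_le_one_of_one_le_of_nonpos h3 (by linarith)
      have h5 : 0 ≤ h⁻¹ := by positivity
      linarith
    · have h4 : h ^ (-y) ≤ h ^ (-1 : ℝ) :=
        Real.rpow_le_rpow_of_exponent_ge hpos h3 (by linarith)
      rw [Real.rpow_neg_one] at h4
      linarith

theorem aestronglyMeasurable_weight (T : Mesh Ω) {p : E N → ℝ} {s : Set (E N)}
    (hs : MeasurableSet s) (hpc : ContinuousOn p s) (μ : Measure (E N)) :
    AEStronglyMeasurable (fun x => T.hloc x ^ (-2 / conj p x)) (μ.restrict s) := by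
  have hpm : AEMeasurable p (μ.restrict s) := hpc.aemeasurable hs
  exact (T.measurable_hloc.aemeasurable.pow
    ((hpm.div (hpm.sub_const 1)).const_div (-2))).aestronglyMeasurable

theorem integrable_mul_weight {T : Mesh Ω} {p : E N → ℝ} {s : Set (E N)}
    (hs : MeasurableSet s) (hpc : ContinuousOn p s) (hp : ∀ x ∈ s, 1 < p x ∧ p x ≤ 2)
    {μ : Measure (E N)} {f : E N → ℝ} (hf : Integrable f (μ.restrict s)) :
    Integrable (fun x => f x * T.hloc x ^ (-2 / conj p x)) (μ.restrict s) := by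
  obtain ⟨C, hC⟩ := T.exists_weight_le hp
  refine hf.mul_bdd (c := C) (T.aestronglyMeasurable_weight hs hpc μ) ?_
  filter_upwards [ae_restrict_mem hs] with x hx using hC x hx

/-! ### Convexity of the functionals -/

theorem integrable_norm_vval_rpow (hΩ : IsPolyhedralDomain Ω) {p : E N → ℝ}
    (hpc : ContinuousOn p Ω) (hp : ∀ x ∈ Ω, 1 < p x ∧ p x ≤ 2) (q : T.H l) :
    Integrable (fun x => ‖vval q x‖ ^ p x) (volume.restrict Ω) := by
  have : IsFiniteMeasure (volume.restrict Ω) := ⟨by simpa using volume_lt_top hΩ⟩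
  obtain ⟨C, hC⟩ := exists_norm_vval_le hΩ q
  refine Integrable.of_bound (((measurable_vval q).norm.aemeasurable.pow
    (hpc.aemeasurable hΩ.isOpen.measurableSet)).aestronglyMeasurable) (max C 1 ^ (2 : ℝ)) ?_
  filter_upwards [ae_restrict_mem hΩ.isOpen.measurableSet] with x hx
  rw [Real.norm_of_nonneg (Real.rpow_nonneg (norm_nonneg _) _)]
  obtain ⟨h1, h2⟩ := hp x hx
  exact (Real.rpow_le_rpow (norm_nonneg _) ((hC x (subset_closure hx)).trans (le_max_left _ _))
    (by linarith)).trans (Real.rpow_le_rpow_of_exponent_le (le_max_right _ _) h2)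

theorem F_segment_le (hΩ : IsPolyhedralDomain Ω) {p : E N → ℝ}
    (hpc : ContinuousOn p Ω) (hp : ∀ x ∈ Ω, 1 < p x ∧ p x ≤ 2) (q w : T.H l) {t : ℝ}
    (ht : 0 ≤ t) (ht1 : t ≤ 1) :
    F p (q + t • (w - q)) ≤ (1 - t) * F p q + t * F p w := by
  have hi := integrable_norm_vval_rpow (T := T) (l := l) hΩ hpc hp
  rw [F, F, F, ← integral_const_mul, ← integral_const_mul,
    ← integral_add ((hi q).const_mul _) ((hi w).const_mul _)]
  refine integral_mono_ae (hi _) (((hi q).const_mul _).add ((hi w).const_mul _)) ?_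
  filter_upwards [ae_restrict_mem hΩ.isOpen.measurableSet] with x hx
  rw [vval_segment]
  exact norm_rpow_segment_le _ _ ht ht1 (hp x hx).1.le

theorem integral_sq_norm_weight_segment_le {Y : Type*} [NormedAddCommGroup Y]
    [InnerProductSpace ℝ Y] {μ : Measure (E N)} {f g h : E N → Y} {w : E N → ℝ} {t : ℝ}
    (ht : 0 ≤ t) (ht1 : t ≤ 1) (hw : ∀ x, 0 ≤ w x) (hh : ∀ x, h x = f x + t • (g x - f x))
    (hfi : Integrable (fun x => ‖f x‖ ^ 2 * w x) μ) (hgi : Integrable (fun x => ‖g x‖ ^ 2 * w x) μ)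
    (hhi : Integrable (fun x => ‖h x‖ ^ 2 * w x) μ) :
    ∫ x, ‖h x‖ ^ 2 * w x ∂μ ≤
      (1 - t) * ∫ x, ‖f x‖ ^ 2 * w x ∂μ + t * ∫ x, ‖g x‖ ^ 2 * w x ∂μ := by
  rw [← integral_const_mul, ← integral_const_mul,
    ← integral_add (hfi.const_mul _) (hgi.const_mul _)]
  refine integral_mono hhi ((hfi.const_mul _).add (hgi.const_mul _)) fun x => ?_
  have h1 : ‖h x‖ ^ 2 ≤ (1 - t) * ‖f x‖ ^ 2 + t * ‖g x‖ ^ 2 := by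
    rw [hh, sq_norm_segment]
    have : 0 ≤ t * (1 - t) * ‖g x - f x‖ ^ 2 :=
      mul_nonneg (mul_nonneg ht (sub_nonneg.2 ht1)) (sq_nonneg _)
    linarith
  have h2 := mul_le_mul_of_nonneg_right h1 (hw x)
  dsimp only
  linarith

theorem sq_norm_toL2 (hΩ : IsPolyhedralDomain Ω) (v : T.S k) :
    ‖toL2 hΩ T k v‖ ^ 2 = ∫ x in Ω, val v x ^ 2 := by
  rw [← real_inner_self_eq_norm_sq]
  refine (inner_toLpLinear (valLin T k) (memLp_val hΩ) (valLin T k) (memLp_val hΩ) v v).trans ?_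
  refine integral_congr_ae (Eventually.of_forall fun x => ?_)
  simp only [valLin, LinearMap.coe_mk, AddHom.coe_mk, real_inner_self_eq_norm_sq, Real.norm_eq_abs,
    sq_abs]

/-- The strong convexity comes from the fidelity term alone, for which the segment identity is
exact; the two face terms only need nonnegative weights. -/
theorem G_segment_le (hΩ : IsPolyhedralDomain Ω) {p ξ uD : E N → ℝ}
    (hpc : ContinuousOn p (closure Ω)) (hp : ∀ x ∈ closure Ω, 1 < p x ∧ p x ≤ 2)
    (hξ : MemLp ξ 2 (volume.restrict Ω)) (huD : MemLp uD 2 ((surf N).restrict (frontier Ω)))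
    (u v : T.S k) {t : ℝ} (ht : 0 ≤ t) (ht1 : t ≤ 1) :
    G p ξ uD (u + t • (v - u)) ≤ (1 - t) * G p ξ uD u + t * G p ξ uD v -
      t * (1 - t) * ‖toL2 hΩ T k (v - u)‖ ^ 2 := by
  have hw : ∀ x, 0 ≤ T.hloc x ^ (-2 / conj p x) := fun x => Real.rpow_nonneg (T.hloc_nonneg x) _
  have hΓ : T.Γint ⊆ closure Ω := T.Γint_subset_closure
  have hi₁ : ∀ v : T.S k, Integrable (fun x => (val v x - ξ x) ^ 2) (volume.restrict Ω) :=
    fun v => ((memLp_val hΩ v).sub hξ).integrable_sq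
  have hi₂ : ∀ v : T.S k, Integrable (fun x => ‖jump v x‖ ^ 2 * T.hloc x ^ (-2 / conj p x))
      ((surf N).restrict T.Γint) := fun v =>
    integrable_mul_weight T.measurableSet_Γint (hpc.mono hΓ) (fun x hx => hp x (hΓ hx))
      (memLp_jump hΩ v).norm.integrable_sq
  have hi₃ : ∀ v : T.S k,
      Integrable (fun x => ‖val v x - uD x‖ ^ 2 * T.hloc x ^ (-2 / conj p x))
      ((surf N).restrict (frontier Ω)) := fun v =>
    integrable_mul_weight isClosed_frontier.measurableSet (hpc.mono frontier_subset_closure)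
      (fun x hx => hp x (frontier_subset_closure hx))
      ((memLp_trace hΩ v).sub huD).norm.integrable_sq
  have h₂ := integral_sq_norm_weight_segment_le ht ht1 hw (jump_segment u v t) (hi₂ u) (hi₂ v)
    (hi₂ (u + t • (v - u)))
  have h₃ := integral_sq_norm_weight_segment_le ht ht1 hw
    (h := fun x => val (u + t • (v - u)) x - uD x) (fun x => by
      rw [val_segment, smul_eq_mul]
      ring) (hi₃ u) (hi₃ v) (hi₃ (u + t • (v - u)))
  have h₁ : ∫ x in Ω, (val (u + t • (v - u)) x - ξ x) ^ 2 =
      (1 - t) * (∫ x in Ω, (val u x - ξ x) ^ 2) + t * (∫ x in Ω, (val v x - ξ x) ^ 2) -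
        t * (1 - t) * ‖toL2 hΩ T k (v - u)‖ ^ 2 := by
    have hi₀ : Integrable (fun x => val (v - u) x ^ 2) (volume.restrict Ω) :=
      (memLp_val hΩ (v - u)).integrable_sq
    have hi₄ : Integrable (fun x => (1 - t) * (val u x - ξ x) ^ 2 + t * (val v x - ξ x) ^ 2)
        (volume.restrict Ω) := ((hi₁ u).const_mul _).add ((hi₁ v).const_mul _)
    rw [sq_norm_toL2, ← integral_const_mul, ← integral_const_mul, ← integral_const_mul,
      ← integral_add ((hi₁ u).const_mul _) ((hi₁ v).const_mul _),
      ← integral_sub hi₄ (hi₀.const_mul _)]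
    refine integral_congr_ae (Eventually.of_forall fun x => ?_)
    have h4 : val (v - u) x = val v x - val u x := congrFun (map_sub (valLin T k) v u) x
    simp only [val_segment, h4]
    ring
  simp only [G, sq_abs]
  simp only [Real.norm_eq_abs, sq_abs] at h₃
  linarith

/-- A minimality condition for a functional that is convex along segments, up to a quadratic
remainder, gives a variational inequality. -/
theorem variational_inequality {V : Type*} [AddCommGroup V] [Module ℝ V] {Φ : V → ℝ} {u v : V}
    {D c : ℝ} (A : V →ₗ[ℝ] ℝ)
    (hΦ : ∀ t : ℝ, 0 ≤ t → t ≤ 1 →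
      Φ (u + t • (v - u)) ≤ (1 - t) * Φ u + t * Φ v - t * (1 - t) * D)
    (hmin : ∀ t : ℝ, 0 ≤ Φ (u + t • (v - u)) - Φ u + A (t • (v - u)) + t ^ 2 * c) :
    D ≤ Φ v - Φ u + A (v - u) := by
  refine le_of_forall_segment (c := c) fun t ht ht1 => ?_
  have h1 := hΦ t ht.le ht1
  have h2 := hmin t
  rw [map_smul, smul_eq_mul] at h2
  linarith

/-! ### Variational inequalities for the saddle point and the iterates. -/

theorem IsSaddle.eta_eq (hΩ : IsPolyhedralDomain Ω) {hkl : k ≤ l + 1} {p ξ uD : E N → ℝ} {r : ℝ}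
    -- Moving the multiplier by the residual itself gives `‖B u - η‖² ≤ 0`.
    {u : T.S k} {η lam : T.H l} (h : IsSaddle hkl p ξ uD r u η lam) : η = B hkl u := by
  have h1 := (h u η (lam + (B hkl u - η))).1
  simp only [Lagr, innerH_eq hΩ, map_add, inner_add_left] at h1
  have h2 : inner ℝ (vtoL2 hΩ T l (B hkl u - η)) (vtoL2 hΩ T l (B hkl u - η)) ≤ (0 : ℝ) := by
    linarith
  have h3 := vtoL2_injective hΩ ((inner_self_eq_zero (𝕜 := ℝ).1
    (le_antisymm h2 real_inner_self_nonneg)).trans (map_zero _).symm)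
  exact (sub_eq_zero.1 h3).symm

/-- The functional `⟨μ, ·⟩` on `H`. -/
def innerWith (hΩ : IsPolyhedralDomain Ω) (μ : T.H l) : T.H l →ₗ[ℝ] ℝ :=
  innerₗ _ (vtoL2 hΩ T l μ) ∘ₗ vtoL2 hΩ T l

theorem innerWith_apply (hΩ : IsPolyhedralDomain Ω) (μ q : T.H l) :
    innerWith hΩ μ q = innerH μ q :=
  (innerH_eq hΩ μ q).symm

theorem innerH_smul_smul (hΩ : IsPolyhedralDomain Ω) (c : ℝ) (q : T.H l) :
    innerH (c • q) (c • q) = c ^ 2 * innerH q q := by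
  simp only [innerH_eq hΩ, map_smul, real_inner_smul_left, real_inner_smul_right]
  ring

/-- With `q = η` fixed, the residual along the segment is `t • B (v - u)`, so the penalty is of
order `t²` and leaves no trace in the first variation. -/
theorem IsSaddle.variational_primal (hΩ : IsPolyhedralDomain Ω) {hkl : k ≤ l + 1}
    {p ξ uD : E N → ℝ} {r : ℝ} (hpc : ContinuousOn p (closure Ω))
    (hp : ∀ x ∈ closure Ω, 1 < p x ∧ p x ≤ 2) (hξ : MemLp ξ 2 (volume.restrict Ω))
    (huD : MemLp uD 2 ((surf N).restrict (frontier Ω)))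
    {u : T.S k} {η lam : T.H l} (h : IsSaddle hkl p ξ uD r u η lam) (v : T.S k) :
    ‖toL2 hΩ T k (v - u)‖ ^ 2 ≤ G p ξ uD v - G p ξ uD u + innerH lam (B hkl (v - u)) := by
  rw [← BLin_apply hΩ, ← innerWith_apply hΩ, ← LinearMap.comp_apply]
  refine variational_inequality (c := r / 2 * innerH (B hkl (v - u)) (B hkl (v - u)))
    (innerWith hΩ lam ∘ₗ BLin hΩ T hkl)
    (fun t ht ht1 => G_segment_le hΩ hpc hp hξ huD u v ht ht1) fun t => ?_
  have h1 := (h (u + t • (v - u)) η lam).2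
  have h2 : B hkl (u + t • (v - u)) = η + t • B hkl (v - u) := by
    rw [h.eta_eq hΩ]
    simp only [← BLin_apply hΩ, map_add, map_smul]
  have h3 : innerH lam 0 = 0 := by rw [← innerWith_apply hΩ, map_zero]
  have h4 : innerH (0 : T.H l) 0 = 0 := by rw [← innerWith_apply hΩ, map_zero]
  simp only [Lagr, h2, add_sub_cancel_left, ← h.eta_eq hΩ, sub_self, h3, h4,
    innerH_smul_smul hΩ] at h1
  rw [LinearMap.comp_apply, map_smul, BLin_apply, innerWith_apply]
  linarith

theorem IsSaddle.variational_dual (hΩ : IsPolyhedralDomain Ω) {hkl : k ≤ l + 1}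
    {p ξ uD : E N → ℝ} {r : ℝ} (hpc : ContinuousOn p (closure Ω))
    (hp : ∀ x ∈ closure Ω, 1 < p x ∧ p x ≤ 2)
    {u : T.S k} {η lam : T.H l} (h : IsSaddle hkl p ξ uD r u η lam) (q : T.H l) :
    0 ≤ F p q - F p η - innerH lam (q - η) := by
  have h0 : F p q - F p η - innerH lam (q - η) =
      F p q - F p η + (-innerWith hΩ lam) (q - η) := by
    rw [LinearMap.neg_apply, innerWith_apply, sub_eq_add_neg]
  rw [h0]
  refine variational_inequality (c := r / 2 * innerH (η - q) (η - q)) (-innerWith hΩ lam)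
    (fun t ht ht1 => ?_) fun t => ?_
  · rw [mul_zero, sub_zero]
    exact F_segment_le hΩ (hpc.mono subset_closure) (fun x hx => hp x (subset_closure hx)) η q ht ht1
  have h1 := (h u (η + t • (q - η)) lam).2
  have hneg : -(t • (q - η)) = t • (η - q) := (smul_neg t (q - η)).symm.trans (by rw [neg_sub])
  have h2 : B hkl u - (η + t • (q - η)) = t • (η - q) := by
    rw [← h.eta_eq hΩ, sub_add_cancel_left, hneg]
  have h3 : innerH lam 0 = 0 := by rw [← innerWith_apply hΩ, map_zero]
  have h4 : innerH (0 : T.H l) 0 = 0 := by rw [← innerWith_apply hΩ, map_zero]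
  have h5 : innerH lam (t • (η - q)) = -innerWith hΩ lam (t • (q - η)) := by
    rw [← innerWith_apply hΩ, ← map_neg, hneg]
  simp only [Lagr, h2, h5, innerH_smul_smul hΩ] at h1
  simp only [← h.eta_eq hΩ, sub_self, h3, h4] at h1
  rw [LinearMap.neg_apply]
  linarith

/-- Testing the defining inequality only along short segments improves its lower bound `0` to the
convexity gap of `G`. -/
theorem IsAlgorithm2.variational_primal (hΩ : IsPolyhedralDomain Ω) {hkl : k ≤ l + 1}
    {p ξ uD : E N → ℝ} {r ρ : ℝ} (hpc : ContinuousOn p (closure Ω))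
    (hp : ∀ x ∈ closure Ω, 1 < p x ∧ p x ≤ 2) (hξ : MemLp ξ 2 (volume.restrict Ω))
    (huD : MemLp uD 2 ((surf N).restrict (frontier Ω)))
    {u : ℕ → T.S k} {η lam : ℕ → T.H l} (h : IsAlgorithm2 hkl p ξ uD r ρ u η lam) {n : ℕ}
    (hn : 1 ≤ n) (v : T.S k) :
    ‖toL2 hΩ T k (v - u n)‖ ^ 2 ≤ G p ξ uD v - G p ξ uD (u n) + (innerH (lam n) (B hkl (v - u n)) +
      r * innerH (B hkl (u n) - η (n - 1)) (B hkl (v - u n))) := by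
  have h0 : innerH (lam n) (B hkl (v - u n)) +
      r * innerH (B hkl (u n) - η (n - 1)) (B hkl (v - u n)) =
      ((innerWith hΩ (lam n) + r • innerWith hΩ (B hkl (u n) - η (n - 1))) ∘ₗ BLin hΩ T hkl)
        (v - u n) := by
    simp only [LinearMap.comp_apply, LinearMap.add_apply, LinearMap.smul_apply, innerWith_apply,
      BLin_apply, smul_eq_mul]
  rw [h0]
  refine variational_inequality (c := 0)
    ((innerWith hΩ (lam n) + r • innerWith hΩ (B hkl (u n) - η (n - 1))) ∘ₗ BLin hΩ T hkl)
    (fun t ht ht1 => G_segment_le hΩ hpc hp hξ huD (u n) v ht ht1) fun t => ?_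
  have h1 := (h n hn).1 (u n + t • (v - u n))
  rw [add_sub_cancel_left] at h1
  simp only [LinearMap.comp_apply, LinearMap.add_apply, LinearMap.smul_apply, innerWith_apply,
    BLin_apply, smul_eq_mul]
  linarith

end Mesh
end DGp
end

/-! ### Convergence of the algorithm. -/

open DGp DGp.Mesh in
theorem theorem1p4 {N : ℕ} (hN : 2 ≤ N) {Ω : Set (E N)} (hΩ : IsPolyhedralDomain Ω) (T : Mesh Ω)
    {k l : ℕ} (hkl : k ≤ l + 1)
    (p : E N → ℝ) (p₁ : ℝ) (hp₁ : 1 < p₁) (hp : ∀ x ∈ closure Ω, p₁ ≤ p x ∧ p x ≤ 2)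
    (hlog : LogHolderOn p (closure Ω))
    (ξ : E N → ℝ) (hξ : MemLp ξ 2 (volume.restrict Ω))
    (uD : E N → ℝ) (huD : MemLp uD 2 ((surf N).restrict (frontier Ω)))
    (r ρ : ℝ) (hρ : 0 < ρ) (hρr : ρ < r * ((1 + √5) / 2))
    (uh : T.S k) (ηh lamh : T.H l) (hsaddle : IsSaddle hkl p ξ uD r uh ηh lamh)
    (u : ℕ → T.S k) (η lam : ℕ → T.H l) (halg : IsAlgorithm2 hkl p ξ uD r ρ u η lam) :
    ηh = B hkl uh ∧
    Tendsto (fun n => normH (η n - ηh)) atTop (𝓝 0) ∧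
    Tendsto (fun n => normH (lam (n + 1) - lam n)) atTop (𝓝 0) ∧
    (∃ C : NNReal, ∀ n : ℕ, 1 ≤ n → normH (lam n) ≤ C) ∧
    Tendsto (fun n => normV (u n - uh)) atTop (𝓝 0) ∧
    Tendsto (fun n => normJump (u n - uh)) atTop (𝓝 0) ∧
    Tendsto (fun n => normBdry (u n - uh)) atTop (𝓝 0) ∧
    Tendsto (fun n => normH (lift l (u n) - lift l uh)) atTop (𝓝 0) ∧
    Tendsto (fun n => normH (grad hkl (u n) - grad hkl uh)) atTop (𝓝 0) := by
  have hpc : ContinuousOn p (closure Ω) := hlog.continuousOn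
  have hp' : ∀ x ∈ closure Ω, 1 < p x ∧ p x ≤ 2 := fun x hx =>
    ⟨hp₁.trans_le (hp x hx).1, (hp x hx).2⟩
  have hη : ηh = B hkl uh := hsaddle.eta_eq hΩ
  set J := vtoL2 hΩ T l with hJ
  set I := toL2 hΩ T k with hI
  let b : ℕ → Lp (E N) 2 (volume.restrict Ω) := fun n => J (BLin hΩ T hkl (u n - uh))
  let e : ℕ → Lp (E N) 2 (volume.restrict Ω) := fun n => J (η n - ηh)
  let L : ℕ → Lp (E N) 2 (volume.restrict Ω) := fun n => J (lam n - lamh)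
  have hb : ∀ n, J (B hkl (u n)) = b n + J ηh := fun n => by
    simp only [b, hη, ← BLin_apply hΩ, map_sub]
    abel
  have he : ∀ n, J (η n) = e n + J ηh := fun n => by simp only [e, map_sub]; abel
  have hL : ∀ n, J (lam n) = L n + J lamh := fun n => by simp only [L, map_sub]; abel
  have hb' : ∀ n, J (B hkl (u n - uh)) = b n := fun n => rfl
  have hb'' : ∀ n, J (B hkl (uh - u n)) = -b n := fun n => by
    rw [← hb', ← map_neg, ← BLin_apply hΩ, ← BLin_apply hΩ, ← map_neg, neg_sub]
  have hs : ∀ n, J (B hkl (u n) - η n) = b n - e n := fun n => by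
    rw [map_sub, hb, he]
    abel
  have hstep : ∀ n, 1 ≤ n → L (n + 1) = L n + ρ • (b n - e n) := fun n hn => by
    simp only [L, (halg n hn).2.2, map_sub, map_add, map_smul, ← hs]
    abel
  obtain ⟨hbe, ha, C, hC⟩ := augmented_lagrangian_convergence hρ hρr (b := b) (e := e) (L := L)
    (a := fun n => ‖I (u n - uh)‖ ^ 2) (fun n => sq_nonneg _)
    -- The iterate is tested with `uh` and the saddle point with `u n`. In the sum `G` cancels and
    -- each side contributes one copy of `‖I (u n - uh)‖ ^ 2`.
    (fun n hn => by
      have h1 := halg.variational_primal hΩ hpc hp' hξ huD hn uh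
      have h2 := hsaddle.variational_primal hΩ hpc hp' hξ huD (u n)
      rw [← neg_sub (u n) uh, map_neg, norm_neg, neg_sub] at h1
      simp only [innerH_eq hΩ, map_sub, ← hJ] at h1 h2
      simp only [hb, hb', hb'', he, hL, ← hI, map_sub, add_sub_add_right_eq_sub, inner_add_left,
        inner_neg_right] at h1 h2 ⊢
      linarith)
    (fun n hn => by
      have h1 := (halg n hn).2.1 ηh
      have h2 := hsaddle.variational_dual hΩ hpc hp' (η n)
      simp only [innerH_eq hΩ, map_sub, ← hJ] at h1 h2
      simp only [hb, he, hL, add_sub_add_right_eq_sub, add_sub_cancel_right, sub_add_cancel_right,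
        inner_add_left, inner_neg_right] at h1 h2
      linarith)
    -- Steps `n` and `n + 1` are tested with each other's `η`, so `F` cancels.
    (fun n hn => by
      have h1 := (halg n hn).2.1 (η (n + 1))
      have h2 := (halg (n + 1) (by omega)).2.1 (η n)
      simp only [innerH_eq hΩ, map_sub, ← hJ] at h1 h2
      simp only [hb, he, hL, add_sub_add_right_eq_sub, inner_add_left, inner_sub_left,
        inner_sub_right] at h1 h2 ⊢
      linarith)
    hstep
  have hI0 : Tendsto (fun n => ‖I (u n - uh)‖) atTop (𝓝 0) := by simpa using ha.sqrt
  have key : ∀ {Z : Type} [NormedAddCommGroup Z] [NormedSpace ℝ Z] (A : T.S k →ₗ[ℝ] Z),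
      Tendsto (fun n => ‖A (u n - uh)‖ₑ) atTop (𝓝 0) := fun A => by
    simpa using (tendsto_zero_of_injective I (toL2_injective hΩ) A hI0).enorm
  -- The energy estimate controls only `b - e`; that `b` itself vanishes comes from `u n → uh` and
  -- finite dimension.
  have hb0 : Tendsto b atTop (𝓝 0) :=
    tendsto_zero_of_injective I (toL2_injective hΩ) (J ∘ₗ BLin hΩ T hkl) hI0
  refine ⟨hη, ?_, ?_, ?_, ?_, ?_, ?_, ?_, ?_⟩
  · simp only [normH_eq hΩ]
    have h1 : Tendsto e atTop (𝓝 0) := by simpa using hb0.sub hbe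
    simpa only [enorm_zero] using h1.enorm
  · simp only [normH_eq hΩ]
    have h1 : Tendsto (fun n => ρ • (b n - e n)) atTop (𝓝 0) := by simpa using hbe.const_smul ρ
    refine Tendsto.congr' ?_ (by simpa using h1.enorm)
    filter_upwards [eventually_ge_atTop 1] with n hn
    rw [(halg n hn).2.2, add_sub_cancel_left, map_smul, ← hJ, hs]
  · refine ⟨(C + ‖J lamh‖).toNNReal, fun n hn => ?_⟩
    rw [normH_eq hΩ, ← ofReal_norm, ← hJ]
    refine ENNReal.ofReal_le_ofReal ?_
    rw [hL]
    exact (norm_add_le _ _).trans (add_le_add_left (hC n hn) _)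
  · simpa only [normV_eq hΩ] using key (toL2 hΩ T k)
  · simpa only [normJump_eq hΩ] using key (jumpL2 hΩ T k)
  · simpa only [normBdry_eq hΩ] using key (traceL2 hΩ T k)
  · have h1 : ∀ n, lift l (u n) - lift l uh = liftLin hΩ T k l (u n - uh) := fun n =>
      (map_sub (liftLin hΩ T k l) (u n) uh).symm
    simp only [normH_eq hΩ, h1]
    exact key (vtoL2 hΩ T l ∘ₗ liftLin hΩ T k l)
  · have h1 : ∀ n, grad hkl (u n) - grad hkl uh = gradLin T hkl (u n - uh) := fun n =>
      (map_sub (gradLin T hkl) (u n) uh).symm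
    simp only [normH_eq hΩ, h1]
    exact key (vtoL2 hΩ T l ∘ₗ gradLin T hkl)
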